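/- Let $r\ge 1$ be an integer and let $a,b\in\mathbb R$. Put $$F_r(a,b)={}_{r+1}F_r\left(\{a\}_r,b;\{a+1\}_r;1\right)=\sum_{n\ge 0}\frac{(a)_n^{\,r}\,(b)_n}{(a+1)_n^{\,r}\,n!},$$ where $\{x\}_r$ denotes $r$ copies of $x$ and $(x)_n=x(x+1)\cdots(x+n-1)$. Assume throughout that $a\notin\{-1,-2,\dots\}$ and that the series converges. Let $\psi=\Gamma'/\Gamma$, let $\psi^{(k)}$ ($k\ge0$) be its derivatives (the polygamma functions), and let $\beta(s)=\sum_{n\ge0}(-1)^n(2n+1)^{-s}$. (1) $F_r(a,b)$ is expressible via polygamma functions, up to an explicit factor of Gamma values, as follows. (1a) There is a polynomial $P$ with rational coefficients, depending only on $r$, such that whenever $a\ne0$, $b\notin\{1,2,\dots\}$ and $a+1-b\notin\{0,-1,-2,\dots\}$, $$F_r(a,b)=a^{r-1}\,\frac{\Gamma(a+1)\Gamma(1-b)}{\Gamma(a+1-b)}\;P\left(\psi^{(k)}(a),\,\psi^{(k)}(a+1-b)\,:\,k\ge0\right).$$ (1b) There is a polynomial $Q$ with rational coefficients, depending only on $r$,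 such that whenever $m=b-a$ is a positive integer and $b\notin\{1,2,\dots\}$, $$F_r(a,b)=(-1)^m a^{r-1}\,\Gamma(a+1)\Gamma(1-b)\Gamma(b-a)\;Q\left(\psi^{(k)}(a),\,\psi^{(k)}(b-a),\,\psi^{(k)}(1)\,:\,k\ge0\right).$$ (1c) For every integer $m\ge1$ there are polynomials $c_0,\dots,c_{r-1}\in\mathbb Q[x]$, depending only on $r$ and $m$, such that whenever $a\neq0$, $$F_r(a,m)=a^r\sum_{j=0}^{r-1}c_j(a)\,\psi^{(j)}(a).$$ (1d) $F_r(0,b)=1$. (2) If $2a,2b\in\mathbb Z$, then $F_r(a,b)$ is a polynomial with rational coefficients in $\pi$, $\log 2$ and the values $\zeta(2k+1)$, $k\ge1$. (3) Let $4a,4b\in\mathbb Z$, and let $R=\mathbb Q[\pi,\log2,\zeta(2k+1),\beta(2j):k,j\ge1]$. If $a\in\mathbb Z$ or $b\in\mathbb Z$, then $F_r(a,b)\in R$. If $b\notin\mathbb Z$, then $$F_r(a,b)\in \frac{\Gamma(a+1)\Gamma(1-b)}{\Gamma(a+1-b)}\,R\quad\text{if } a+1-b\notin\{0,-1,-2,\dots\},\qquad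 F_r(a,b)\in\Gamma(a+1)\Gamma(1-b)\,R\quad\text{otherwise}.$$ -/

import Mathlib

noncomputable section

/-- The `n`-th term `(a₁)ₙ ⋯ (aₚ)ₙ / ((b₁)ₙ ⋯ (b_q)ₙ) · zⁿ / n!` of the generalized hypergeometric
series `pFq(a₁, …, aₚ; b₁, …, b_q; z)`, where `(x)ₙ` is the rising factorial. -/
def hypergeometricTerm (as bs : List ℝ) (z : ℝ) (n : ℕ) : ℝ :=
  (as.map fun a => (ascPochhammer ℝ n).eval a).prod /
    (bs.map fun b => (ascPochhammer ℝ n).eval b).prod * z ^ n / (n.factorial : ℝ)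

/-- The value of the generalized hypergeometric series `pFq(as; bs; z)`. -/
def hypergeometricValue (as bs : List ℝ) (z : ℝ) : ℝ :=
  ∑' n : ℕ, hypergeometricTerm as bs z n

/-- The series `pFq(as; bs; z)` is defined (no lower parameter is a nonpositive integer)
and converges. -/
def HypergeometricConverges (as bs : List ℝ) (z : ℝ) : Prop :=
  (∀ b ∈ bs, ∀ k : ℕ, b ≠ -(k : ℝ)) ∧ Summable (hypergeometricTerm as bs z)

/-- The upper parameters `{a}_r, b`. -/
def upperParams (r : ℕ) (a b : ℝ) : List ℝ := List.replicate r a ++ [b]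

/-- The lower parameters `{a+1}_r`. -/
def lowerParams (r : ℕ) (a : ℝ) : List ℝ := List.replicate r (a + 1)

/-- The polygamma function `ψ⁽ᵏ⁾`, the `k`-th derivative of `ψ = Γ'/Γ`. -/
def polygamma (k : ℕ) (x : ℝ) : ℝ := iteratedDeriv k (logDeriv Real.Gamma) x

/-- The value of a polynomial with rational coefficients in variables `X_{i,k}` at
`X_{i,k} = ψ⁽ᵏ⁾(xᵢ)`. -/
def polygammaEval {d : ℕ} (x : Fin d → ℝ) (P : MvPolynomial (Fin d × ℕ) ℚ) : ℝ :=
  MvPolynomial.aeval (fun p : Fin d × ℕ => polygamma p.2 (x p.1)) P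

/-- The Dirichlet beta value `β(s) = ∑ (-1)ⁿ / (2n+1)ˢ` (absolutely convergent for `s ≥ 2`). -/
def dirichletBeta (s : ℕ) : ℝ := ∑' n : ℕ, (-1 : ℝ) ^ n / (2 * (n : ℝ) + 1) ^ s

/-- The odd zeta values `ζ(3), ζ(5), ζ(7), …`, as real numbers. -/
def oddZetaValues : Set ℝ :=
  {x | ∃ k : ℕ, 1 ≤ k ∧ x = (riemannZeta ((2 * k + 1 : ℕ) : ℂ)).re}

/-- The beta values `β(2), β(4), β(6), …`. -/
def evenBetaValues : Set ℝ := {x | ∃ j : ℕ, 1 ≤ j ∧ x = dirichletBeta (2 * j)}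

/-- The ring `ℚ[π, log 2, ζ(3), ζ(5), …]`. -/
def levelTwoRing : Subalgebra ℚ ℝ :=
  Algebra.adjoin ℚ ({Real.pi, Real.log 2} ∪ oddZetaValues)

/-- The ring `ℚ[π, log 2, ζ(3), ζ(5), …, β(2), β(4), …]`. -/
def levelFourRing : Subalgebra ℚ ℝ :=
  Algebra.adjoin ℚ ({Real.pi, Real.log 2} ∪ oddZetaValues ∪ evenBetaValues)

end

/-! Since $(a)_n/(a+1)_n = a/(a+n)$, for regular $a$ one has $F_r(a,b) = a^r S_r(a,b)$ with
$S_r(a,b) = \sum_n (b)_n/(n!\,(a+n)^r)$. Differentiation in $a$ gives $S_r' = -r S_{r+1}$, so for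
$b<1$ the sum $S_{n+1}$ is $(-1)^n/n!$ times the $n$-th derivative of $S_1$. Gauss's theorem
(`shiftedSum_one_eq`) evaluates $S_1$ as the beta value $B = \Gamma(a)\Gamma(1-b)/\Gamma(a+1-b)$.
Its logarithmic derivative is $\psi(a)-\psi(a+1-b)$, so every derivative is $B$ times a Bell-type
polynomial in polygamma differences.

For larger noninteger $b$ the series $S_1$ diverges while $S_r$ may converge. The relation
$b\,S_{r+1}(a,b+1) = S_r(a,b)+(b-a)S_{r+1}(a,b)$ is the differentiated form of
$b\,B(a,b+1)=(b-a)B(a,b)$, so $S_{n+1}$ remains a normalized derivative of $B$ whenever $b<n+1$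
(`exists_chain`).

If $b-a$ is a positive integer, $B$ vanishes. Reflection isolates the vanishing factor
$\sin(\pi(b-a))/\pi$, which satisfies $\sigma''=-\pi^2\sigma$; only the terms containing $\sigma'$
survive, and $\pi^2 = 6\psi'(1)$. If $b$ is a positive integer, the same relation in $b$ descends to
$b=1$, where the sums are polygamma values.

For the arithmetic statements, duplication, reflection, and the values $\zeta(2k)$ and $\beta(2k+1)$
place the polygamma values in the rings, modulo $\psi(1)$. That constant cancels because $\psi$
itself enters only through differences. In the integer and half-integer cases the Gamma factor is
rational or a rational multiple of $\pi$. -/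

noncomputable section

open Filter Topology Asymptotics

namespace BetaSeries

/-! ### Coefficients, shifted sums and regular points -/

/-- The binomial-type coefficient `(b)ₙ / n!`. -/
def coeff (b : ℝ) (n : ℕ) : ℝ := (ascPochhammer ℝ n).eval b / (n.factorial : ℝ)

/-- The series `∑ (b)ₙ / (n! (a + n) ^ r)`. -/
def shiftedSum (r : ℕ) (a b : ℝ) : ℝ := ∑' n : ℕ, coeff b n / (a + n) ^ r

/-- The real numbers which are not nonpositive integers. -/
def regular : Set ℝ := {x | ∀ n : ℕ, x + n ≠ 0}

theorem coeff_zero (b : ℝ) : coeff b 0 = 1 := by simp [coeff]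

theorem coeff_succ (b : ℝ) (n : ℕ) : (n + 1) * coeff b (n + 1) = (b + n) * coeff b n := by
  have h : (n.factorial : ℝ) ≠ 0 := by positivity
  have h1 : (n : ℝ) + 1 ≠ 0 := by positivity
  simp only [coeff, ascPochhammer_succ_eval, Nat.factorial_succ, Nat.cast_mul, Nat.cast_succ]
  field_simp

theorem mul_coeff_add_one (b : ℝ) (n : ℕ) : b * coeff (b + 1) n = (b + n) * coeff b n := by
  induction n with
  | zero => simp [coeff_zero]
  | succ n ih =>
    have h1 : (n : ℝ) + 1 ≠ 0 := by positivity
    apply mul_left_cancel₀ h1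
    have e1 := coeff_succ (b + 1) n
    have e2 := coeff_succ b n
    push_cast
    linear_combination b * e1 + (b + 1 + n) * ih - (b + n + 1) * e2

theorem sum_range_coeff (b : ℝ) (n : ℕ) :
    ∑ i ∈ Finset.range (n + 1), coeff b i = coeff (b + 1) n := by
  induction n with
  | zero => simp [coeff_zero]
  | succ n ih =>
    rw [Finset.sum_range_succ, ih]
    have h1 : (n : ℝ) + 1 ≠ 0 := by positivity
    apply mul_left_cancel₀ h1
    have e1 := coeff_succ (b + 1) n
    have e2 := coeff_succ b n
    have e3 := mul_coeff_add_one b n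
    linear_combination e2 - e1 - e3

theorem regular_of_pos {x : ℝ} (hx : 0 < x) : x ∈ regular := fun n => by positivity

theorem regular_iff {x : ℝ} : x ∈ regular ↔ ∀ n : ℕ, x ≠ -(n : ℝ) :=
  forall_congr' fun _ => not_congr eq_neg_iff_add_eq_zero.symm

theorem regular_ne_zero {x : ℝ} (hx : x ∈ regular) : x ≠ 0 := by simpa using hx 0

theorem regular_add_one {x : ℝ} (hx : x ∈ regular) : x + 1 ∈ regular := fun n => by
  have := hx (n + 1)
  push_cast at this
  convert this using 1
  ring

theorem regular_of_add_one {x : ℝ} (h0 : x ≠ 0) (hx : x + 1 ∈ regular) : x ∈ regular := by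
  intro n
  cases n with
  | zero => simpa using h0
  | succ n =>
    have := hx n
    push_cast
    convert this using 1
    ring

theorem isOpen_regular : IsOpen regular := by
  have h : regular = (Set.range fun n : ℕ => -(n : ℝ))ᶜ := by
    ext x
    simp only [regular_iff, Set.mem_compl_iff, Set.mem_range, not_exists]
    exact forall_congr' fun n => not_congr eq_comm
  rw [h, isOpen_compl_iff]
  exact ((Homeomorph.neg ℝ).isClosedEmbedding.comp Nat.isClosedEmbedding_coe_real).isClosed_range

theorem one_regular : (1 : ℝ) ∈ regular := regular_of_pos one_pos

/-! ### Growth of the coefficients and convergence -/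

theorem eval_ascPochhammer (b : ℝ) (n : ℕ) :
    (ascPochhammer ℝ n).eval b = ∏ j ∈ Finset.range n, (b + j) := by
  induction n with
  | zero => simp
  | succ n ih => rw [ascPochhammer_succ_eval, ih, Finset.prod_range_succ]

/-- Euler's limit for $\Gamma$: the quotient of the two sides is $n/(n+1)$ divided by `Real.GammaSeq
b n`, and the latter tends to $\Gamma(b)\ne0$. -/
theorem coeff_isTheta {b : ℝ} (hb : b ∈ regular) :
    (fun n : ℕ => coeff b (n + 1)) =Θ[atTop] fun n : ℕ => (n : ℝ) ^ (b - 1) := by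
  have hG : Real.Gamma b ≠ 0 := Real.Gamma_ne_zero (regular_iff.1 hb)
  have h1 : Tendsto (fun n : ℕ => (Real.GammaSeq b n)⁻¹ * ((n : ℝ) / (n + 1))) atTop
      (𝓝 ((Real.Gamma b)⁻¹ * 1)) :=
    ((Real.GammaSeq_tendsto_Gamma b).inv₀ hG).mul (tendsto_natCast_div_add_atTop 1)
  have h2 : (fun n : ℕ => (Real.GammaSeq b n)⁻¹ * ((n : ℝ) / (n + 1))) =Θ[atTop]
      fun _ => (1 : ℝ) := by
    refine ⟨h1.isBigO_one ℝ, ?_⟩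
    refine (isBigO_const_left_iff_pos_le_norm one_ne_zero).2 ?_
    have hne : (Real.Gamma b)⁻¹ * 1 ≠ 0 := by simpa using hG
    refine ⟨‖(Real.Gamma b)⁻¹ * 1‖ / 2, by positivity, ?_⟩
    have := h1.norm.eventually (lt_mem_nhds (half_lt_self (norm_pos_iff.2 hne)))
    filter_upwards [this] with n hn using hn.le
  have h3 := h2.mul (isTheta_refl (fun n : ℕ => (n : ℝ) ^ (b - 1)) atTop)
  refine IsTheta.trans (EventuallyEq.isTheta ?_) (h3.trans (EventuallyEq.isTheta ?_))
  · filter_upwards [eventually_gt_atTop 0] with n hn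
    have hn' : (0 : ℝ) < n := by exact_mod_cast hn
    have hp : (∏ j ∈ Finset.range (n + 1), (b + j)) ≠ 0 :=
      Finset.prod_ne_zero_iff.2 fun j _ => hb j
    have hr : (n : ℝ) ^ (b - 1) ≠ 0 := by positivity
    have hf : (n.factorial : ℝ) ≠ 0 := by positivity
    rw [coeff, eval_ascPochhammer, Real.GammaSeq, Nat.factorial_succ]
    have : (n : ℝ) ^ b = (n : ℝ) ^ (b - 1) * n := by
      rw [← Real.rpow_add_one hn'.ne']; ring_nf
    rw [this]
    push_cast
    field_simp
  · filter_upwards with n using one_mul _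

theorem exists_of_not_regular {b : ℝ} (hb : b ∉ regular) : ∃ k : ℕ, b = -(k : ℝ) := by
  simpa [regular_iff] using hb

theorem coeff_eq_zero {k n : ℕ} (h : k < n) : coeff (-(k : ℝ)) n = 0 := by
  rw [coeff, eval_ascPochhammer,
    Finset.prod_eq_zero (Finset.mem_range.2 h) (by simp), zero_div]

theorem coeff_isBigO (b : ℝ) :
    (fun n : ℕ => coeff b (n + 1)) =O[atTop] fun n : ℕ => (n : ℝ) ^ (b - 1) := by
  by_cases hb : b ∈ regular
  · exact (coeff_isTheta hb).1
  · obtain ⟨k, rfl⟩ := exists_of_not_regular hb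
    refine (EventuallyEq.isBigO (f₂ := fun _ => (0 : ℝ)) ?_).trans (isBigO_zero _ _)
    filter_upwards [eventually_ge_atTop k] with n hn using coeff_eq_zero (by omega)

theorem tendsto_coeff {b : ℝ} (hb : b < 1) : Tendsto (coeff b) atTop (𝓝 0) := by
  rw [← tendsto_add_atTop_iff_nat 1]
  refine (coeff_isBigO b).trans_tendsto ?_
  have := (tendsto_rpow_neg_atTop (y := 1 - b) (by linarith)).comp tendsto_natCast_atTop_atTop
  simpa [Function.comp_def] using this

theorem inv_add_pow_isTheta (a : ℝ) (r : ℕ) :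
    (fun n : ℕ => ((a + (n + 1 : ℕ)) ^ r)⁻¹) =Θ[atTop] fun n : ℕ => ((n : ℝ) ^ r)⁻¹ := by
  have h : (fun n : ℕ => a + ((n + 1 : ℕ) : ℝ)) ~[atTop] fun n : ℕ => (n : ℝ) := by
    have : (fun _ : ℕ => a + 1) =o[atTop] fun n : ℕ => (n : ℝ) := by
      refine isLittleO_const_left.2 (Or.inr ?_)
      exact tendsto_norm_atTop_atTop.comp tendsto_natCast_atTop_atTop
    refine this.congr_left fun n => ?_
    simp; ring
  exact (h.isTheta.pow r).inv

theorem rpow_mul_inv_pow (b : ℝ) (r : ℕ) :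
    (fun n : ℕ => (n : ℝ) ^ (b - 1) * ((n : ℝ) ^ r)⁻¹) =ᶠ[atTop]
      fun n : ℕ => (n : ℝ) ^ (b - 1 - r) := by
  filter_upwards [eventually_gt_atTop 0] with n hn
  have hn' : (0 : ℝ) < n := by exact_mod_cast hn
  rw [Real.rpow_sub_natCast hn'.ne', div_eq_mul_inv]

theorem summable_shifted (a : ℝ) {b : ℝ} {r : ℕ} (h : b < r) :
    Summable fun n : ℕ => coeff b n / (a + n) ^ r := by
  rw [← summable_nat_add_iff 1]
  refine summable_of_isBigO_nat (g := fun n : ℕ => (n : ℝ) ^ (b - 1 - r))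
    (Real.summable_nat_rpow.2 (by linarith)) ?_
  exact ((coeff_isBigO b).mul (inv_add_pow_isTheta a r).1).trans (rpow_mul_inv_pow b r).isBigO

/-- For regular $b$ the terms have exact order $n^{b-1-r}$, so the $p$-series test is also
necessary. Otherwise $b\le0<r$. -/
theorem lt_of_summable_shifted {a b : ℝ} {r : ℕ} (hr : 1 ≤ r)
    (h : Summable fun n : ℕ => coeff b n / (a + n) ^ r) : b < r := by
  by_cases hb : b ∈ regular
  · rw [← summable_nat_add_iff 1] at h
    have hO : (fun n : ℕ => (n : ℝ) ^ (b - 1 - r)) =O[atTop]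
        fun n : ℕ => coeff b (n + 1) / (a + (n + 1 : ℕ)) ^ r :=
      (rpow_mul_inv_pow b r).symm.isBigO.trans
        ((coeff_isTheta hb).2.mul (inv_add_pow_isTheta a r).2)
    have := Real.summable_nat_rpow.1 (summable_of_isBigO_nat h hO)
    linarith
  · obtain ⟨k, rfl⟩ := exists_of_not_regular hb
    have h1 : (1 : ℝ) ≤ r := by exact_mod_cast hr
    have h2 : (0 : ℝ) ≤ k := by positivity
    linarith

/-! ### Contiguous relations -/

theorem shiftedSum_zero_right (a : ℝ) (r : ℕ) : shiftedSum r a 0 = (a ^ r)⁻¹ := by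
  rw [shiftedSum, tsum_eq_single 0]
  · simp [coeff_zero]
  · intro n hn
    have := coeff_eq_zero (k := 0) (n := n) (by omega)
    simp at this
    simp [this]

/-- The partial sums are $(b+1)_n/n!$, which tend to $0$ because $b+1<1$; this is $(1-1)^{-b}=0$. -/
theorem shiftedSum_zero_left (a : ℝ) {b : ℝ} (hb : b < 0) : shiftedSum 0 a b = 0 := by
  have hs := (summable_shifted a (r := 0) (b := b) (by simpa using hb)).hasSum.tendsto_sum_nat
  rw [← tendsto_add_atTop_iff_nat 1] at hs
  refine tendsto_nhds_unique hs ?_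
  simp only [pow_zero, div_one, sum_range_coeff]
  exact tendsto_coeff (by linarith)

/-- Termwise: $b\,(b+1)_n = (b+n)(b)_n$, followed by the splitting $b+n=(a+n)+(b-a)$. -/
theorem shiftedSum_contiguous {a b : ℝ} (ha : a ∈ regular) {r : ℕ} (h : b < r) :
    b * shiftedSum (r + 1) a (b + 1) = shiftedSum r a b + (b - a) * shiftedSum (r + 1) a b := by
  have h1 := summable_shifted a h
  have h2 := summable_shifted a (b := b) (r := r + 1) (by push_cast; linarith)
  rw [shiftedSum, shiftedSum, shiftedSum, ← tsum_mul_left, ← tsum_mul_left,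
    ← h1.tsum_add (h2.mul_left _)]
  refine tsum_congr fun n => ?_
  have := ha n
  have e := mul_coeff_add_one b n
  rw [mul_div_assoc', e]
  field_simp
  ring

/-- The difference of the two series telescopes. The first term of the sum at $a$ is kept apart so
that $a=0$ is allowed; that case gives $S_1(1,b)=1/(1-b)$, the normalization needed for
Bohr–Mollerup. -/
theorem shiftedSum_one_left_add_one {a b : ℝ} (ha : a + 1 ∈ regular) (hb : b < 1) :
    (a + 1 - b) * shiftedSum 1 (a + 1) b = 1 + a * ∑' n : ℕ, coeff b (n + 1) / (a + (n + 1 : ℕ)) := by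
  have hs := summable_shifted (a + 1) (b := b) (r := 1) (by simpa using hb)
  have hs' := (summable_nat_add_iff 1).2 (summable_shifted a (b := b) (r := 1) (by simpa using hb))
  simp only [pow_one] at hs hs'
  have hsum := (hs.mul_left (a + 1 - b)).sub (hs'.mul_left a)
  have key : ∀ n : ℕ, (a + 1 - b) * (coeff b n / (a + 1 + n)) -
      a * (coeff b (n + 1) / (a + (n + 1 : ℕ))) = coeff b n - coeff b (n + 1) := by
    intro n
    have h0 := ha n
    have h0' : a + ((n + 1 : ℕ) : ℝ) = a + 1 + n := by push_cast; ring
    have e := coeff_succ b n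
    rw [h0']
    field_simp
    linear_combination e
  have ht := hsum.hasSum.tendsto_sum_nat
  simp only [key, Finset.sum_range_sub'] at ht
  have hl : Tendsto (fun n => coeff b 0 - coeff b n) atTop (𝓝 (1 - 0)) := by
    rw [coeff_zero]
    exact tendsto_const_nhds.sub (tendsto_coeff hb)
  have := tendsto_nhds_unique ht hl
  rw [← tsum_congr key, (hs.mul_left _).tsum_sub (hs'.mul_left _), tsum_mul_left, tsum_mul_left]
    at this
  simp only [shiftedSum, pow_one]
  linarith

theorem shiftedSum_one_left_shift {a b : ℝ} (ha : a ∈ regular) (hb : b < 1) :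
    (a + 1 - b) * shiftedSum 1 (a + 1) b = a * shiftedSum 1 a b := by
  rw [shiftedSum_one_left_add_one (regular_add_one ha) hb, shiftedSum,
    (summable_shifted a (b := b) (r := 1) (by simpa using hb)).tsum_eq_zero_add, mul_add]
  have := regular_ne_zero ha
  simp [coeff_zero, this]

/-! ### Termwise differentiation in $a$ -/

/-- The convergent sequence $(n+1)/|a+n|$ is bounded by some $M$, and moving $a$ by less than
$1/(2M)$ costs at most half of the lower bound. This supplies the locally uniform majorant for
termwise differentiation. -/
theorem exists_uniform_bound {a : ℝ} (ha : a ∈ regular) :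
    ∃ δ > 0, ∀ y ∈ Metric.ball a δ, ∀ n : ℕ, δ * (n + 1) ≤ |y + n| := by
  have h : Tendsto (fun n : ℕ => ((n : ℝ) + 1) / |a + n|) atTop (𝓝 1) := by
    have h1 : Tendsto (fun n : ℕ => ((n : ℝ) + a) / (n + 1)) atTop (𝓝 1) := by
      have h2 := (tendsto_natCast_div_add_atTop (1 : ℝ)).add
        ((tendsto_one_div_add_atTop_nhds_zero_nat (𝕜 := ℝ)).const_mul a)
      simp only [mul_zero, add_zero] at h2
      refine h2.congr fun n => ?_
      ring
    have h3 := (h1.abs.inv₀ (by simp))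
    simp only [abs_one, inv_one] at h3
    refine h3.congr fun n => ?_
    have : (0 : ℝ) < n + 1 := by positivity
    rw [abs_div, abs_of_pos this, inv_div, add_comm a]
  obtain ⟨M, hM⟩ := h.bddAbove_range
  have hM' : ∀ n : ℕ, (n + 1 : ℝ) ≤ M * |a + n| := fun n =>
    (div_le_iff₀ (abs_pos.2 (ha n))).1 (hM ⟨n, rfl⟩)
  have hM0 : 0 < M := by
    have := hM' 0
    by_contra hneg
    have h2 := mul_nonneg (neg_nonneg.2 (not_lt.1 hneg)) (abs_nonneg (a + (0 : ℕ)))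
    simp only [Nat.cast_zero] at this h2
    linarith
  refine ⟨1 / (2 * M), by positivity, fun y hy n => ?_⟩
  have h1 : |y - a| < 1 / (2 * M) := by simpa [Real.dist_eq] using hy
  have h2 : |a + n| ≤ |y + n| + |y - a| := by
    have := abs_sub_abs_le_abs_sub (a + n) (y + n)
    have e : a + (n : ℝ) - (y + n) = -(y - a) := by ring
    rw [e, abs_neg] at this
    linarith
  have h3 : (n + 1 : ℝ) / M ≤ |a + n| := by
    rw [div_le_iff₀ hM0, mul_comm]; exact hM' n
  have h4 : 1 / (2 * M) * (n + 1 : ℝ) + 1 / (2 * M) ≤ (n + 1) / M := by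
    have : (n + 1 : ℝ) / M = 1 / (2 * M) * (n + 1 : ℝ) + 1 / (2 * M) + 1 / (2 * M) * n := by
      field_simp; ring
    rw [this]
    have : (0 : ℝ) ≤ 1 / (2 * M) * n := by positivity
    linarith
  linarith

/-- Termwise differentiation of `∑ (cₙ / (a + n) ^ r - dₙ)`. -/
theorem hasDerivAt_tsum_shifted {c d : ℕ → ℝ} {r : ℕ}
    (hc : Summable fun n : ℕ => |c n| / ((n : ℝ) + 1) ^ (r + 1)) {a : ℝ} (ha : a ∈ regular)
    (hs : Summable fun n : ℕ => c n / (a + n) ^ r - d n) :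
    HasDerivAt (fun x => ∑' n : ℕ, (c n / (x + n) ^ r - d n))
      (-r * ∑' n : ℕ, c n / (a + n) ^ (r + 1)) a := by
  obtain ⟨δ, hδ, hb⟩ := exists_uniform_bound ha
  have hne : ∀ y ∈ Metric.ball a δ, ∀ n : ℕ, y + (n : ℝ) ≠ 0 := fun y hy n h0 => by
    have := hb y hy n
    rw [h0, abs_zero] at this
    have : 0 < δ * ((n : ℝ) + 1) := by positivity
    linarith
  have key := hasDerivAt_tsum_of_isPreconnected (g := fun n x => c n / (x + n) ^ r - d n)
    (g' := fun n x => -r * (c n / (x + n) ^ (r + 1)))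
    (hc.mul_left (r / δ ^ (r + 1))) Metric.isOpen_ball (convex_ball a δ).isPreconnected
    ?_ ?_ (Metric.mem_ball_self hδ) hs (Metric.mem_ball_self hδ)
  · rwa [tsum_mul_left] at key
  · intro n y hy
    have h0 := hne y hy n
    have h1 : HasDerivAt (fun x : ℝ => (x + n) ^ r) (r * (y + n) ^ (r - 1) * 1) y :=
      ((hasDerivAt_id y).add_const (n : ℝ)).pow r
    have h2 := ((h1.inv (pow_ne_zero r h0)).const_mul (c n)).sub_const (d n)
    have e : -(r : ℝ) * (c n / (y + n) ^ (r + 1)) =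
        c n * (-(r * (y + n) ^ (r - 1) * 1) / ((y + n) ^ r) ^ 2) := by
      cases r with
      | zero => simp
      | succ r =>
        simp only [Nat.add_sub_cancel]
        field_simp
        ring
    rw [e]
    exact h2
  · intro n y hy
    have h1 := hb y hy n
    have h2 : (δ * ((n : ℝ) + 1)) ^ (r + 1) ≤ |y + n| ^ (r + 1) := by gcongr
    rw [Real.norm_eq_abs, abs_mul, abs_neg, Nat.abs_cast, abs_div, abs_pow, div_mul_div_comm,
      ← mul_pow, mul_div_assoc]
    gcongr

theorem hasDerivAt_shiftedSum {a b : ℝ} (ha : a ∈ regular) {r : ℕ} (h : b < r) :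
    HasDerivAt (fun x => shiftedSum r x b) (-r * shiftedSum (r + 1) a b) a := by
  have hs : Summable fun n : ℕ => |coeff b n| / ((n : ℝ) + 1) ^ (r + 1) := by
    refine (summable_shifted 1 (b := b) (r := r + 1) (by push_cast; linarith)).abs.congr fun n => ?_
    have : (0 : ℝ) < 1 + n := by positivity
    rw [abs_div, abs_pow, abs_of_pos this, add_comm]
  have := hasDerivAt_tsum_shifted (d := fun _ => 0) hs ha (by simpa using summable_shifted a h)
  simp only [sub_zero] at this
  exact this

/-! ### Digamma and polygamma as series -/

theorem polygamma_zero : polygamma 0 = logDeriv Real.Gamma :=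
  funext fun x => by simp [polygamma]

theorem polygamma_succ (k : ℕ) : polygamma (k + 1) = deriv (polygamma k) :=
  funext fun x => by rw [polygamma, iteratedDeriv_succ]; rfl

theorem hasDerivAt_Gamma {x : ℝ} (hx : x ∈ regular) :
    HasDerivAt Real.Gamma (Real.Gamma x * polygamma 0 x) x := by
  have h := (Real.differentiableAt_Gamma (regular_iff.1 hx)).hasDerivAt
  have h0 := Real.Gamma_ne_zero (regular_iff.1 hx)
  rwa [polygamma_zero, logDeriv_apply, mul_div_cancel₀ _ h0]

theorem Gamma_ne_zero {x : ℝ} (hx : x ∈ regular) : Real.Gamma x ≠ 0 :=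
  Real.Gamma_ne_zero (regular_iff.1 hx)

theorem digamma_add_one {x : ℝ} (hx : x ∈ regular) :
    polygamma 0 (x + 1) = polygamma 0 x + 1 / x := by
  have hx0 := regular_ne_zero hx
  have hG := Gamma_ne_zero hx
  have h1 : HasDerivAt (fun y => Real.Gamma (y + 1))
      (Real.Gamma (x + 1) * polygamma 0 (x + 1)) x :=
    (hasDerivAt_Gamma (regular_add_one hx)).comp_add_const x 1
  have h2 : HasDerivAt (fun y => y * Real.Gamma y)
      (1 * Real.Gamma x + x * (Real.Gamma x * polygamma 0 x)) x :=
    (hasDerivAt_id x).mul (hasDerivAt_Gamma hx)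
  have h3 : (fun y => Real.Gamma (y + 1)) =ᶠ[𝓝 x] fun y => y * Real.Gamma y := by
    filter_upwards [isOpen_ne.mem_nhds hx0] with y hy using Real.Gamma_add_one hy
  have h4 := h1.unique (h2.congr_of_eventuallyEq h3)
  rw [Real.Gamma_add_one hx0] at h4
  field_simp
  apply mul_left_cancel₀ hG
  linarith

theorem regular_add_nat {x : ℝ} (hx : x ∈ regular) (N : ℕ) : x + N ∈ regular := by
  induction N with
  | zero => simpa using hx
  | succ N ih =>
    have := regular_add_one ih
    push_cast
    rwa [← add_assoc]

theorem digamma_add_nat {x : ℝ} (hx : x ∈ regular) (N : ℕ) :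
    polygamma 0 (x + N) = polygamma 0 x + ∑ i ∈ Finset.range N, 1 / (x + i) := by
  induction N with
  | zero => simp
  | succ N ih =>
    rw [Finset.sum_range_succ, ← add_assoc, ← ih, ← digamma_add_one (regular_add_nat hx N)]
    push_cast
    rw [add_assoc]

theorem digamma_monotoneOn : MonotoneOn (polygamma 0) (Set.Ioi 0) := by
  have hd : ∀ x ∈ Set.Ioi (0 : ℝ), HasDerivAt (Real.log ∘ Real.Gamma) (polygamma 0 x) x := by
    intro x hx
    have hG := Gamma_ne_zero (regular_of_pos hx)
    have := (hasDerivAt_Gamma (regular_of_pos hx)).log hG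
    rwa [mul_div_cancel_left₀ _ hG] at this
  have := Real.convexOn_log_Gamma.monotoneOn_deriv fun x hx => (hd x hx).differentiableAt
  exact this.congr fun x hx => (hd x hx).deriv

/-- Log-convexity of $\Gamma$ makes $\psi$ increasing. With $K\ge x-y$, the value $\psi(x+N)$ is at
most $\psi(y+N+K)$, which exceeds $\psi(y+N)$ by $K$ reciprocals that tend to $0$. -/
theorem digamma_sub_le {x y : ℝ} (hx : 0 < x) (hy : 0 < y) :
    ∃ u : ℕ → ℝ, Tendsto u atTop (𝓝 0) ∧
      ∀ N : ℕ, polygamma 0 (x + N) - polygamma 0 (y + N) ≤ u N := by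
  obtain ⟨K, hK⟩ := exists_nat_ge (x - y)
  refine ⟨fun N => ∑ i ∈ Finset.range K, 1 / (y + N + i), ?_, fun N => ?_⟩
  · have : ∀ i ∈ Finset.range K, Tendsto (fun N : ℕ => 1 / (y + N + i)) atTop (𝓝 0) := by
      intro i _
      refine Tendsto.div_atTop tendsto_const_nhds ?_
      exact tendsto_atTop_add_const_right _ _
        (tendsto_atTop_add_const_left _ _ tendsto_natCast_atTop_atTop)
    simpa using tendsto_finsetSum _ this
  · have hyN : 0 < y + N := by positivity
    have h1 := digamma_add_nat (regular_of_pos hyN) K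
    have h2 : polygamma 0 (x + N) ≤ polygamma 0 (y + N + K) :=
      digamma_monotoneOn (by simp only [Set.mem_Ioi]; positivity)
        (by simp only [Set.mem_Ioi]; positivity) (by linarith)
    linarith

theorem tendsto_digamma_sub_of_pos {x y : ℝ} (hx : 0 < x) (hy : 0 < y) :
    Tendsto (fun N : ℕ => polygamma 0 (x + N) - polygamma 0 (y + N)) atTop (𝓝 0) := by
  obtain ⟨u, hu, hu'⟩ := digamma_sub_le hx hy
  obtain ⟨v, hv, hv'⟩ := digamma_sub_le hy hx
  refine tendsto_of_tendsto_of_tendsto_of_le_of_le (g := fun N => -v N) ?_ hu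
    (fun N => by have := hv' N; simp only; linarith) hu'
  simpa using hv.neg

theorem summable_sub_inv (x : ℝ) :
    Summable fun n : ℕ => (-1 : ℝ) / (x + n) ^ 1 - -1 / (1 + n) ^ 1 := by
  rw [← summable_nat_add_iff 1]
  refine summable_of_isBigO_nat (g := fun n : ℕ => ((n : ℝ) ^ 2)⁻¹)
    (Real.summable_nat_pow_inv.2 (by norm_num)) ?_
  have h := (((inv_add_pow_isTheta x 1).1.mul (inv_add_pow_isTheta 1 1).1).const_mul_left (x - 1))
  refine (EventuallyEq.isBigO ?_).trans (h.trans (EventuallyEq.isBigO ?_))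
  · obtain ⟨K, hK⟩ := exists_nat_ge (-x)
    filter_upwards [eventually_ge_atTop K] with n hn
    have hn' : (K : ℝ) ≤ n := by exact_mod_cast hn
    have h1 : x + ((n + 1 : ℕ) : ℝ) ≠ 0 := by
      push_cast; linarith
    have h2 : 1 + ((n + 1 : ℕ) : ℝ) ≠ 0 := by positivity
    field_simp
    ring
  · filter_upwards with n
    rw [← mul_inv]; ring_nf

/-- Iterating $\psi(x+1)=\psi(x)+1/x$ from $x$ and from $1$ leaves the remainder
$\psi(x+N)-\psi(1+N)\to0$. The summand has the shape required by `hasDerivAt_tsum_shifted` with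
$r=1$, the second fraction being the convergence-restoring constant. -/
theorem digamma_eq_tsum {x : ℝ} (hx : x ∈ regular) :
    polygamma 0 x = polygamma 0 1 + ∑' n : ℕ, ((-1 : ℝ) / (x + n) ^ 1 - -1 / (1 + n) ^ 1) := by
  have hlim : Tendsto (fun N : ℕ => polygamma 0 (x + N) - polygamma 0 (1 + N)) atTop (𝓝 0) := by
    obtain ⟨M, hM⟩ := exists_nat_gt (-x)
    rw [← tendsto_add_atTop_iff_nat M]
    have := tendsto_digamma_sub_of_pos (x := x + M) (y := 1 + M) (by linarith) (by positivity)
    refine this.congr fun N => ?_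
    push_cast
    ring_nf
  have h := (summable_sub_inv x).hasSum.tendsto_sum_nat
  have h2 : Tendsto (fun N : ℕ => ∑ n ∈ Finset.range N,
      ((-1 : ℝ) / (x + n) ^ 1 - -1 / (1 + n) ^ 1)) atTop
      (𝓝 (polygamma 0 x - polygamma 0 1 - 0)) := by
    refine (hlim.const_sub (polygamma 0 x - polygamma 0 1)).congr fun N => ?_
    rw [digamma_add_nat hx, digamma_add_nat one_regular, Finset.sum_sub_distrib]
    simp only [neg_div, pow_one, Finset.sum_neg_distrib]
    ring
  have := tendsto_nhds_unique h h2
  linarith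

theorem coeff_one (n : ℕ) : coeff 1 n = 1 := by
  induction n with
  | zero => exact coeff_zero 1
  | succ n ih =>
    have := coeff_succ 1 n
    rw [ih] at this
    have h : (n : ℝ) + 1 ≠ 0 := by positivity
    apply mul_left_cancel₀ h
    linarith

theorem hasDerivAt_digamma {x : ℝ} (hx : x ∈ regular) :
    HasDerivAt (polygamma 0) (shiftedSum 2 x 1) x := by
  have hs : Summable fun n : ℕ => |(-1 : ℝ)| / ((n : ℝ) + 1) ^ (1 + 1) := by
    refine (summable_shifted 1 (b := 1) (r := 2) (by norm_num)).congr fun n => ?_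
    simp [coeff_one, add_comm]
  have h := (hasDerivAt_tsum_shifted (c := fun _ => -1) (d := fun n => -1 / (1 + (n : ℝ)) ^ 1)
    hs hx (summable_sub_inv x)).const_add (polygamma 0 1)
  have e : -((1 : ℕ) : ℝ) * ∑' n : ℕ, (-1 : ℝ) / (x + n) ^ (1 + 1) = shiftedSum 2 x 1 := by
    rw [← tsum_mul_left, shiftedSum]
    refine tsum_congr fun n => ?_
    rw [coeff_one]
    norm_num [neg_div]
  rw [e] at h
  refine h.congr_of_eventuallyEq ?_
  filter_upwards [isOpen_regular.mem_nhds hx] with y hy using digamma_eq_tsum hy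

theorem polygamma_succ_eq (k : ℕ) {x : ℝ} (hx : x ∈ regular) :
    polygamma (k + 1) x = (-1) ^ k * (k + 1).factorial * shiftedSum (k + 2) x 1 := by
  induction k generalizing x with
  | zero =>
    have := (hasDerivAt_digamma hx).deriv
    simpa [polygamma_succ] using this
  | succ k ih =>
    have h1 : polygamma (k + 1) =ᶠ[𝓝 x]
        fun y => (-1) ^ k * (k + 1).factorial * shiftedSum (k + 2) y 1 := by
      filter_upwards [isOpen_regular.mem_nhds hx] with y hy using ih hy
    have h2 := ((hasDerivAt_shiftedSum hx (b := 1) (r := k + 2) (by push_cast; linarith)).const_mul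
      ((-1 : ℝ) ^ k * (k + 1).factorial)).congr_of_eventuallyEq h1
    rw [polygamma_succ]
    refine h2.deriv.trans ?_
    rw [Nat.factorial_succ (k + 1), pow_succ]
    push_cast
    ring

theorem hasDerivAt_polygamma (k : ℕ) {x : ℝ} (hx : x ∈ regular) :
    HasDerivAt (polygamma k) (polygamma (k + 1) x) x := by
  have hd : DifferentiableAt ℝ (polygamma k) x := by
    cases k with
    | zero => exact (hasDerivAt_digamma hx).differentiableAt
    | succ k =>
      have h1 : polygamma (k + 1) =ᶠ[𝓝 x]
          fun y => (-1) ^ k * (k + 1).factorial * shiftedSum (k + 2) y 1 := by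
        filter_upwards [isOpen_regular.mem_nhds hx] with y hy using polygamma_succ_eq k hy
      exact (((hasDerivAt_shiftedSum hx (b := 1) (r := k + 2) (by push_cast; linarith)).const_mul
        ((-1 : ℝ) ^ k * (k + 1).factorial)).congr_of_eventuallyEq h1).differentiableAt
  have := hd.hasDerivAt
  rwa [← polygamma_succ] at this

/-! ### Gauss's summation through Bohr–Mollerup -/

/-- `Γ(a) Γ(1 - b) / Γ(a + 1 - b)`, the value of the beta function at `(a, 1 - b)`. -/
def betaValue (a b : ℝ) : ℝ := Real.Gamma a * Real.Gamma (1 - b) / Real.Gamma (a + 1 - b)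

theorem coeff_pos {b : ℝ} (hb : 0 < b) (n : ℕ) : 0 < coeff b n :=
  div_pos (ascPochhammer_pos n b hb) (by positivity)

theorem shiftedSum_one_pos {a b : ℝ} (ha : 0 < a) (hb : 0 < b) (hb1 : b < 1) :
    0 < shiftedSum 1 a b := by
  refine (summable_shifted a (r := 1) (by simpa using hb1)).tsum_pos (fun n => ?_) 0 ?_
  · have := coeff_pos hb n
    positivity
  · simp [coeff_zero, ha]

theorem inv_weighted_le {x y s t : ℝ} (hx : 0 < x) (hy : 0 < y) (hs : 0 ≤ s) (ht : 0 ≤ t)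
    (hst : s + t = 1) : (s * x + t * y)⁻¹ ≤ (x⁻¹) ^ s * (y⁻¹) ^ t := by
  have h := Real.geom_mean_le_arith_mean2_weighted hs ht hx.le hy.le hst
  rw [Real.inv_rpow hx.le, Real.inv_rpow hy.le, ← mul_inv]
  exact inv_anti₀ (by positivity) h

/-- Each $1/(a+n)$ is log-convex in $a$ by weighted AM–GM, and Hölder with exponents $1/s$, $1/t$
passes this to the sum. The condition $0<b<1$ gives positive terms and convergence. -/
theorem shiftedSum_one_log_convex {b : ℝ} (hb : 0 < b) (hb1 : b < 1) :
    ConvexOn ℝ (Set.Ioi 0) fun a => Real.log (shiftedSum 1 a b) := by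
  refine convexOn_iff_forall_pos.2 ⟨convex_Ioi 0, fun x hx y hy s t hs ht hst => ?_⟩
  have hx' : (0 : ℝ) < x := hx
  have hy' : (0 : ℝ) < y := hy
  have hz : 0 < s * x + t * y := by positivity
  have hSx := shiftedSum_one_pos hx' hb hb1
  have hSy := shiftedSum_one_pos hy' hb hb1
  have hSz := shiftedSum_one_pos hz hb hb1
  have sx := summable_shifted x (b := b) (r := 1) (by simpa using hb1)
  have sy := summable_shifted y (b := b) (r := 1) (by simpa using hb1)
  have sz := summable_shifted (s * x + t * y) (b := b) (r := 1) (by simpa using hb1)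
  have nx : ∀ n : ℕ, 0 ≤ coeff b n / (x + n) ^ 1 := fun n => by
    have := coeff_pos hb n; positivity
  have ny : ∀ n : ℕ, 0 ≤ coeff b n / (y + n) ^ 1 := fun n => by
    have := coeff_pos hb n; positivity
  have hpq : (s⁻¹).HolderConjugate t⁻¹ :=
    Real.holderConjugate_iff.2 ⟨(one_lt_inv₀ hs).2 (by linarith), by simpa using hst⟩
  have rs : ∀ {v : ℝ}, 0 ≤ v → (v ^ s) ^ s⁻¹ = v := fun hv => by
    rw [← Real.rpow_mul hv, mul_inv_cancel₀ hs.ne', Real.rpow_one]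
  have rt : ∀ {v : ℝ}, 0 ≤ v → (v ^ t) ^ t⁻¹ = v := fun hv => by
    rw [← Real.rpow_mul hv, mul_inv_cancel₀ ht.ne', Real.rpow_one]
  have e1 : (fun n : ℕ => ((coeff b n / (x + n) ^ 1) ^ s) ^ s⁻¹) =
      fun n : ℕ => coeff b n / (x + n) ^ 1 := funext fun n => rs (nx n)
  have e2 : (fun n : ℕ => ((coeff b n / (y + n) ^ 1) ^ t) ^ t⁻¹) =
      fun n : ℕ => coeff b n / (y + n) ^ 1 := funext fun n => rt (ny n)
  have fs : ∀ n : ℕ, 0 ≤ (coeff b n / (x + n) ^ 1) ^ s := fun n => Real.rpow_nonneg (nx n) s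
  have gs : ∀ n : ℕ, 0 ≤ (coeff b n / (y + n) ^ 1) ^ t := fun n => Real.rpow_nonneg (ny n) t
  have hold := Real.inner_le_Lp_mul_Lq_tsum_of_nonneg hpq fs gs (by rwa [e1]) (by rwa [e2])
  have hsum := Real.summable_mul_of_Lp_Lq_of_nonneg hpq fs gs (by rwa [e1]) (by rwa [e2])
  rw [e1, e2, one_div, one_div, inv_inv, inv_inv] at hold
  have hle : shiftedSum 1 (s * x + t * y) b ≤ shiftedSum 1 x b ^ s * shiftedSum 1 y b ^ t := by
    refine (Summable.tsum_le_tsum (fun n => ?_) sz hsum).trans hold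
    have hc := coeff_pos hb n
    have h := inv_weighted_le (x := x + n) (y := y + n) (by positivity) (by positivity)
      hs.le ht.le hst
    have e : s * (x + n) + t * (y + n) = s * x + t * y + n := by
      linear_combination (n : ℝ) * hst
    rw [e] at h
    rw [pow_one, pow_one, pow_one, div_eq_mul_inv, div_eq_mul_inv, div_eq_mul_inv,
      Real.mul_rpow hc.le (by positivity), Real.mul_rpow hc.le (by positivity)]
    have e3 : coeff b n ^ s * coeff b n ^ t = coeff b n := by
      rw [← Real.rpow_add hc, hst, Real.rpow_one]
    calc coeff b n * (s * x + t * y + n)⁻¹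
        ≤ coeff b n * (((x + n)⁻¹) ^ s * ((y + n)⁻¹) ^ t) := by gcongr
      _ = (coeff b n ^ s * coeff b n ^ t) * (((x + n)⁻¹) ^ s * ((y + n)⁻¹) ^ t) := by rw [e3]
      _ = _ := by ring
  have := Real.log_le_log hSz hle
  rw [Real.log_mul (by positivity) (by positivity), Real.log_rpow hSx, Real.log_rpow hSy] at this
  simpa using this

/-- Bohr–Mollerup for $x\mapsto S_1(x,b)\Gamma(x+1-b)/\Gamma(1-b)$: it is log-convex, satisfies the
functional equation of $\Gamma$, and equals $1$ at $1$. -/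
theorem shiftedSum_one_eq_of_pos_of_mem {a b : ℝ} (ha : 0 < a) (hb : 0 < b) (hb1 : b < 1) :
    shiftedSum 1 a b = betaValue a b := by
  have hG1 : 0 < Real.Gamma (1 - b) := Real.Gamma_pos_of_pos (by linarith)
  have hG : ∀ {x : ℝ}, 0 < x → 0 < Real.Gamma (x + 1 - b) := fun hx =>
    Real.Gamma_pos_of_pos (by linarith)
  have key := Real.eq_Gamma_of_log_convex
    (f := fun x => shiftedSum 1 x b * Real.Gamma (x + 1 - b) / Real.Gamma (1 - b)) ?_ ?_ ?_ ?_
  · have h := key (Set.mem_Ioi.2 ha)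
    have := (hG ha).ne'
    simp only at h
    rw [betaValue, ← h]
    field_simp
  · have h1 : ConvexOn ℝ (Set.Ioi 0) fun x : ℝ => Real.log (Real.Gamma (x + 1 - b)) := by
      have h := (Real.convexOn_log_Gamma.translate_right (1 - b))
      refine (h.subset (fun x hx => ?_) (convex_Ioi 0)).congr fun x _ => ?_
      · have : (0 : ℝ) < x := hx
        simp only [Set.mem_preimage, Set.mem_Ioi]
        linarith
      · simp only [Function.comp_apply]
        congr 2
        ring
    refine (((shiftedSum_one_log_convex hb hb1).add h1).add
      (convexOn_const (-Real.log (Real.Gamma (1 - b))) (convex_Ioi 0))).congr fun x hx => ?_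
    simp only [Function.comp_apply, Pi.add_apply]
    rw [Real.log_div (mul_pos (shiftedSum_one_pos hx hb hb1) (hG hx)).ne' hG1.ne',
      Real.log_mul (shiftedSum_one_pos hx hb hb1).ne' (hG hx).ne']
    ring
  · intro y hy
    have h := shiftedSum_one_left_shift (regular_of_pos hy) hb1
    have e : y + 1 + 1 - b = y + 1 - b + 1 := by ring
    simp only [e]
    rw [Real.Gamma_add_one (by linarith)]
    field_simp
    linear_combination Real.Gamma (y + 1 - b) * h
  · intro y hy
    exact div_pos (mul_pos (shiftedSum_one_pos hy hb hb1) (hG hy)) hG1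
  · have h := shiftedSum_one_left_add_one (a := 0) (b := b) (by simpa using one_regular) hb1
    simp only [zero_add, zero_mul, add_zero] at h
    have e : (1 : ℝ) + 1 - b = 1 - b + 1 := by ring
    simp only [e]
    rw [Real.Gamma_add_one (by linarith)]
    field_simp
    linear_combination h

/-- No condition on $a+1-b$ is needed: `Real.Gamma` is $0$ at its poles, so the quotient is $0$
there, in agreement with $1/\Gamma=0$. -/
theorem betaValue_add_one_right (a : ℝ) {b : ℝ} (hb : b ≠ 0) :
    b * betaValue a (b + 1) = (b - a) * betaValue a b := by
  have h1 : Real.Gamma (1 - b) = -b * Real.Gamma (-b) := by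
    rw [← Real.Gamma_add_one (neg_ne_zero.2 hb)]; ring_nf
  have e1 : 1 - (b + 1) = -b := by ring
  have e2 : a + 1 - (b + 1) = a - b := by ring
  have e3 : a + 1 - b = a - b + 1 := by ring
  rw [betaValue, betaValue, e1, e2, e3, h1]
  by_cases h : a - b = 0
  · simp [h, show b - a = 0 by linarith]
  · rw [Real.Gamma_add_one h]
    field_simp
    ring

theorem betaValue_add_one_left {a : ℝ} (ha : a ≠ 0) (b : ℝ) :
    (a + 1 - b) * betaValue (a + 1) b = a * betaValue a b := by
  have e : a + 1 + 1 - b = a + 1 - b + 1 := by ring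
  rw [betaValue, betaValue, e, Real.Gamma_add_one ha]
  by_cases h : a + 1 - b = 0
  · simp [h]
  · rw [Real.Gamma_add_one h]
    field_simp

/-- Descent in $b$ by unit steps from $0<b<1$: at $r=0$ the contiguous relation loses its $S_0$ term
and becomes the recurrence of the beta value. At $b=0$ one cannot divide by $b$, but there the
series is the single term $1/a$. -/
theorem shiftedSum_one_eq_of_pos {a b : ℝ} (ha : 0 < a) (hb1 : b < 1) :
    shiftedSum 1 a b = betaValue a b := by
  obtain ⟨k, hk⟩ := exists_nat_gt (-b)
  induction k generalizing b with
  | zero =>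
    simp only [Nat.cast_zero, Left.neg_neg_iff] at hk
    exact shiftedSum_one_eq_of_pos_of_mem ha hk hb1
  | succ k ih =>
    rcases lt_trichotomy b 0 with hb | rfl | hb
    · have h := ih (b := b + 1) (by linarith) (by push_cast at hk; linarith)
      have h1 := shiftedSum_contiguous (r := 0) (regular_of_pos ha) (by simpa using hb)
      rw [shiftedSum_zero_left a hb, zero_add, zero_add, h,
        betaValue_add_one_right a hb.ne] at h1
      exact (mul_left_cancel₀ (by linarith) h1).symm
    · rw [shiftedSum_zero_right, betaValue, pow_one, sub_zero, sub_zero, Real.Gamma_one,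
        Real.Gamma_add_one ha.ne', mul_one]
      have := Gamma_ne_zero (regular_of_pos ha)
      field_simp
    · exact shiftedSum_one_eq_of_pos_of_mem ha hb hb1

/-- Gauss' summation of `∑ (b)ₙ / (n! (a + n))`. -/
theorem shiftedSum_one_eq {a b : ℝ} (ha : a ∈ regular) (hb1 : b < 1) :
    shiftedSum 1 a b = betaValue a b := by
  obtain ⟨k, hk⟩ := exists_nat_gt (-a)
  induction k generalizing a with
  | zero => exact shiftedSum_one_eq_of_pos (by simpa using hk) hb1
  | succ k ih =>
    have h := ih (regular_add_one ha) (by push_cast at hk; linarith)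
    have h1 := shiftedSum_one_left_shift ha hb1
    have ha0 := regular_ne_zero ha
    rw [h, betaValue_add_one_left ha0] at h1
    exact (mul_left_cancel₀ ha0 h1).symm

/-! ### Chains of normalized derivatives and continuation in $b$ -/

/-- The functions `W n` are the normalized derivatives `(-1)ⁿ / n! • dⁿ/dxⁿ` of `W 0` on `U`. -/
def IsChain (U : Set ℝ) (W : ℕ → ℝ → ℝ) : Prop :=
  ∀ n : ℕ, ∀ x ∈ U, HasDerivAt (W n) (-((n : ℝ) + 1) * W (n + 1) x) x

theorem IsChain.eqOn {U : Set ℝ} (hU : IsOpen U) {W V : ℕ → ℝ → ℝ} (hW : IsChain U W)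
    (hV : IsChain U V) (h : Set.EqOn (W 0) (V 0) U) (n : ℕ) : Set.EqOn (W n) (V n) U := by
  induction n with
  | zero => exact h
  | succ n ih =>
    intro x hx
    have h1 : V n =ᶠ[𝓝 x] W n := by
      filter_upwards [hU.mem_nhds hx] with y hy using (ih hy).symm
    have := (hV n x hx).unique ((hW n x hx).congr_of_eventuallyEq h1)
    have h0 : -((n : ℝ) + 1) ≠ 0 := by
      have : (0 : ℝ) < n + 1 := by positivity
      linarith
    exact (mul_left_cancel₀ h0 this).symm

/-- The step from `b` to `b + 1` in a chain. -/
def chainShift (b : ℝ) (W : ℕ → ℝ → ℝ) : ℕ → ℝ → ℝ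
  | 0, x => b⁻¹ * ((b - x) * W 0 x)
  | n + 1, x => b⁻¹ * ((b - x) * W (n + 1) x + W n x)

/-- Leibniz's rule with an affine factor: the $n$-th normalized derivative of $(b-x)W_0$ is
$(b-x)W_n+W_{n-1}$, which has the form of the contiguous relation. -/
theorem IsChain.chainShift {U : Set ℝ} {W : ℕ → ℝ → ℝ} (hW : IsChain U W) (b : ℝ) :
    IsChain U (chainShift b W) := by
  intro n x hx
  have hb : HasDerivAt (fun y : ℝ => b - y) (-1) x := (hasDerivAt_id x).const_sub b
  cases n with
  | zero =>
    refine ((hb.mul (hW 0 x hx)).const_mul b⁻¹).congr_deriv ?_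
    simp only [BetaSeries.chainShift, Nat.cast_zero]
    ring
  | succ n =>
    refine (((hb.mul (hW (n + 1) x hx)).add (hW n x hx)).const_mul b⁻¹).congr_deriv ?_
    simp only [BetaSeries.chainShift, Nat.cast_succ]
    ring

/-- Continuation in $b$: the derivatives of the beta value exist for all these $b$, but the series
represents `W n` only when $b<n+1$. Each step applies the contiguous relation from $b-1$ to $b$;
excluding positive integers keeps the divisor $b-1$ nonzero. -/
theorem exists_chain {b : ℝ} (hb : ∀ m : ℕ, b ≠ m + 1) :
    ∃ W : ℕ → ℝ → ℝ, IsChain regular W ∧ (∀ a ∈ regular, W 0 a = betaValue a b) ∧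
      ∀ n : ℕ, b < n + 1 → ∀ a ∈ regular, W n a = shiftedSum (n + 1) a b := by
  obtain ⟨k, hk⟩ := exists_nat_gt (b - 1)
  induction k generalizing b with
  | zero =>
    have hb1 : b < 1 := by simpa using hk
    refine ⟨fun n a => shiftedSum (n + 1) a b, fun n a ha => ?_, fun a ha => ?_, fun _ _ _ _ => rfl⟩
    · have hn : (0 : ℝ) ≤ n := by positivity
      simpa using hasDerivAt_shiftedSum (b := b) (r := n + 1) ha (by push_cast; linarith)
    · exact shiftedSum_one_eq ha hb1
  | succ k ih =>
    by_cases hk' : b - 1 < k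
    · exact ih hb hk'
    have hb0 : b - 1 ≠ 0 := fun h => hb 0 (by simp; linarith)
    have hb1 : 0 ≤ b - 1 := le_trans (by positivity) (not_lt.1 hk')
    obtain ⟨W, hW, h0, h⟩ := ih (b := b - 1)
      (fun m hm => hb (m + 1) (by push_cast; linarith)) (by push_cast at hk; linarith)
    refine ⟨chainShift (b - 1) W, hW.chainShift _, fun a ha => ?_, fun n hn a ha => ?_⟩
    · have := betaValue_add_one_right a hb0
      rw [sub_add_cancel] at this
      rw [chainShift, h0 a ha, ← this, inv_mul_cancel_left₀ hb0]
    · cases n with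
      | zero => simp only [Nat.cast_zero] at hn; linarith
      | succ n =>
        have := shiftedSum_contiguous (b := b - 1) (r := n + 1) ha (by push_cast at hn ⊢; linarith)
        rw [sub_add_cancel] at this
        rw [chainShift, h (n + 1) (by push_cast at hn ⊢; linarith) a ha,
          h n (by push_cast at hn; linarith) a ha, inv_mul_eq_iff_eq_mul₀ hb0, this]
        ring

/-! ### Bell-type polynomials -/

/-- The derivation of `ℚ[p, X₀, X₁, …]` with `p ↦ 0` and `Xₖ ↦ Xₖ₊₁`. -/
def shiftDerivation :
    Derivation ℚ (MvPolynomial (Option ℕ) ℚ) (MvPolynomial (Option ℕ) ℚ) :=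
  MvPolynomial.mkDerivation ℚ fun i => i.elim 0 fun k => MvPolynomial.X (some (k + 1))

/-- The universal polynomials `(uₙ, vₙ)` for which `(-1)ⁿ/n! · dⁿ/dxⁿ (H σ) = H (uₙ σ + vₙ σ')`
whenever `H' = H X₀` and `σ'' = -p σ`. -/
def bellPair : ℕ → MvPolynomial (Option ℕ) ℚ × MvPolynomial (Option ℕ) ℚ
  | 0 => (1, 0)
  | n + 1 =>
    let u := (bellPair n).1
    let v := (bellPair n).2
    (MvPolynomial.C (-1 / ((n : ℚ) + 1)) *
      (shiftDerivation u + MvPolynomial.X (some 0) * u - MvPolynomial.X none * v),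
     MvPolynomial.C (-1 / ((n : ℚ) + 1)) *
      (shiftDerivation v + MvPolynomial.X (some 0) * v + u))

/-- The evaluation `p ↦ c`, `Xₖ ↦ d k`. -/
def bellEval (c : ℝ) (d : ℕ → ℝ) : MvPolynomial (Option ℕ) ℚ →ₐ[ℚ] ℝ :=
  MvPolynomial.aeval fun i => i.elim c d

theorem hasDerivAt_bellEval (c : ℝ) {d : ℕ → ℝ → ℝ} {x : ℝ}
    (hd : ∀ k, HasDerivAt (d k) (d (k + 1) x) x) (P : MvPolynomial (Option ℕ) ℚ) :
    HasDerivAt (fun y => bellEval c (fun k => d k y) P)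
      (bellEval c (fun k => d k x) (shiftDerivation P)) x := by
  induction P using MvPolynomial.induction_on with
  | C q =>
    have : shiftDerivation (MvPolynomial.C q) = 0 := MvPolynomial.derivation_C _ q
    rw [this, map_zero]
    simp only [bellEval, MvPolynomial.algHom_C]
    exact hasDerivAt_const x _
  | add P Q hP hQ =>
    simp only [map_add]
    exact hP.add hQ
  | mul_X P i hP =>
    have hX : HasDerivAt (fun y => bellEval c (fun k => d k y) (MvPolynomial.X i))
        (bellEval c (fun k => d k x) (shiftDerivation (MvPolynomial.X i))) x := by
      rw [shiftDerivation, MvPolynomial.mkDerivation_X]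
      cases i with
      | none => simpa [bellEval] using hasDerivAt_const x c
      | some k => simpa [bellEval] using hd k
    simp only [map_mul, Derivation.leibniz, smul_eq_mul, map_add]
    refine (hP.mul hX).congr_deriv ?_
    ring

/-- The product rule, with $\tau=\sigma'$ and $\tau'=-c\sigma$, reproduces the recursion of
`bellPair`. The factor $H$ carries nonvanishing Gamma values, while $\sigma$ carries a factor that
may vanish; generic parameters take $\sigma=1$, $\tau=0$, $c=0$. -/
theorem isChain_bellPair {U : Set ℝ} {H σ τ : ℝ → ℝ} {d : ℕ → ℝ → ℝ} {c : ℝ}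
    (hH : ∀ x ∈ U, HasDerivAt H (H x * d 0 x) x)
    (hd : ∀ k, ∀ x ∈ U, HasDerivAt (d k) (d (k + 1) x) x)
    (hσ : ∀ x ∈ U, HasDerivAt σ (τ x) x) (hτ : ∀ x ∈ U, HasDerivAt τ (-c * σ x) x) :
    IsChain U fun n x => H x * (bellEval c (fun k => d k x) (bellPair n).1 * σ x +
      bellEval c (fun k => d k x) (bellPair n).2 * τ x) := by
  intro n x hx
  have hu := hasDerivAt_bellEval c (fun k => hd k x hx) (bellPair n).1
  have hv := hasDerivAt_bellEval c (fun k => hd k x hx) (bellPair n).2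
  refine ((hH x hx).mul ((hu.mul (hσ x hx)).add (hv.mul (hτ x hx)))).congr_deriv ?_
  have hn : (n : ℝ) + 1 ≠ 0 := by positivity
  have hC : bellEval c (fun k => d k x) (MvPolynomial.C (-1 / ((n : ℚ) + 1))) =
      -1 / ((n : ℝ) + 1) := by
    simp [bellEval]
  have hX0 : bellEval c (fun k => d k x) (MvPolynomial.X (some 0)) = d 0 x := by simp [bellEval]
  have hXn : bellEval c (fun k => d k x) (MvPolynomial.X none) = c := by simp [bellEval]
  simp only [bellPair, map_mul, map_add, map_sub, hC, hX0, hXn, Pi.add_apply, Pi.mul_apply]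
  field_simp
  ring

/-! ### Closed forms for the shifted sums -/

theorem hasDerivAt_Gamma_comp {g : ℝ → ℝ} {x g' : ℝ} (hx : g x ∈ regular)
    (hg : HasDerivAt g g' x) :
    HasDerivAt (fun y => Real.Gamma (g y)) (Real.Gamma (g x) * (polygamma 0 (g x) * g')) x :=
  ((hasDerivAt_Gamma hx).comp x hg).congr_deriv (by ring)

theorem hasDerivAt_betaValue {a b : ℝ} (ha : a ∈ regular) (hab : a + 1 - b ∈ regular) :
    HasDerivAt (fun x => betaValue x b)
      (betaValue a b * (polygamma 0 a - polygamma 0 (a + 1 - b))) a := by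
  have h1 := hasDerivAt_Gamma ha
  have h2 := hasDerivAt_Gamma_comp (g := fun x => x + 1 - b) hab
    (((hasDerivAt_id a).add_const 1).sub_const b)
  have h0 := Gamma_ne_zero hab
  refine ((h1.mul_const (Real.Gamma (1 - b))).div h2 h0).congr_deriv ?_
  rw [betaValue]
  field_simp

/-- Generic parameters: `∑ (b)ₖ / (k! (a + k) ^ (n + 1))` equals a beta value times a polynomial in
differences of polygamma values. -/
theorem shiftedSum_eq_generic {a b : ℝ} {n : ℕ} (ha : a ∈ regular) (hb : ∀ m : ℕ, b ≠ m + 1)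
    (hab : a + 1 - b ∈ regular) (hn : b < n + 1) :
    shiftedSum (n + 1) a b = betaValue a b *
      bellEval 0 (fun k => polygamma k a - polygamma k (a + 1 - b)) (bellPair n).1 := by
  obtain ⟨W, hW, h0, h⟩ := exists_chain hb
  have hcont : Continuous fun x : ℝ => x + 1 - b := by fun_prop
  have hU : IsOpen (regular ∩ {x : ℝ | x + 1 - b ∈ regular}) :=
    isOpen_regular.inter (isOpen_regular.preimage hcont)
  have hV := isChain_bellPair (U := regular ∩ {x : ℝ | x + 1 - b ∈ regular})
    (H := fun x => betaValue x b) (σ := fun _ => 1) (τ := fun _ => 0) (c := 0)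
    (d := fun k x => polygamma k x - polygamma k (x + 1 - b))
    (fun x hx => hasDerivAt_betaValue hx.1 hx.2)
    (fun k x hx => by
      refine ((hasDerivAt_polygamma k hx.1).sub ((hasDerivAt_polygamma k hx.2).comp x
        (((hasDerivAt_id x).add_const 1).sub_const b))).congr_deriv ?_
      ring)
    (fun x _ => hasDerivAt_const x 1)
    (fun x _ => (hasDerivAt_const x (0 : ℝ)).congr_deriv (by simp))
  have := (IsChain.eqOn hU (fun n x hx => hW n x hx.1) hV (fun x hx => by
    simp [h0 x hx.1, bellPair]) n) ⟨ha, hab⟩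
  rw [← h n hn a ha, this]
  ring

/-- Reflection at $b-a>0$, where $\Gamma(b-a)$ is finite and positive: the zeros of
$1/\Gamma(a+1-b)$ are moved into the sine. -/
theorem betaValue_eq_sin {a b : ℝ} (hab : a < b) :
    betaValue a b = Real.Gamma (1 - b) * (Real.Gamma a * Real.Gamma (b - a)) *
      (Real.sin (Real.pi * (b - a)) / Real.pi) := by
  have h := Real.Gamma_mul_Gamma_one_sub (b - a)
  have hpos : 0 < Real.Gamma (b - a) := Real.Gamma_pos_of_pos (by linarith)
  have e : 1 - (b - a) = a + 1 - b := by ring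
  rw [e] at h
  rw [betaValue]
  by_cases hs : Real.sin (Real.pi * (b - a)) = 0
  · rw [hs, div_zero] at h
    rcases mul_eq_zero.1 h with h | h
    · exact absurd h hpos.ne'
    · simp [h, hs]
  · have hG : Real.Gamma (a + 1 - b) = Real.pi / Real.sin (Real.pi * (b - a)) /
        Real.Gamma (b - a) := by
      rw [eq_div_iff hpos.ne', ← h, mul_comm]
    rw [hG]
    have := Real.pi_ne_zero
    field_simp

/-- The case in which `b - a` is a positive integer. -/
theorem shiftedSum_eq_of_sub_eq_nat {a b : ℝ} {n m : ℕ} (ha : a ∈ regular)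
    (hb : ∀ m : ℕ, b ≠ m + 1) (hm : 1 ≤ m) (hab : b - a = m) (hn : b < n + 1) :
    shiftedSum (n + 1) a b = (-1) ^ m *
      (Real.Gamma a * Real.Gamma (1 - b) * Real.Gamma (b - a)) *
      -bellEval (Real.pi ^ 2)
        (fun k => polygamma k a + (-1) ^ (k + 1) * polygamma k (b - a)) (bellPair n).2 := by
  obtain ⟨W, hW, h0, h⟩ := exists_chain hb
  have hU : IsOpen (regular ∩ Set.Iio b) := isOpen_regular.inter isOpen_Iio
  have hpi := Real.pi_ne_zero
  have hsub : ∀ x : ℝ, HasDerivAt (fun y => b - y) (-1) x := fun x => (hasDerivAt_id x).const_sub b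
  have hr : ∀ x ∈ regular ∩ Set.Iio b, b - x ∈ regular := fun x hx =>
    regular_of_pos (sub_pos.2 hx.2)
  have hpisub : ∀ x : ℝ, HasDerivAt (fun y => Real.pi * (b - y)) (-Real.pi) x := fun x =>
    ((hsub x).const_mul Real.pi).congr_deriv (by ring)
  -- Here $\tau=\sigma'$ and $\sigma''=-\pi^2\sigma$. The logarithmic derivative of
  -- $\Gamma(x)\Gamma(b-x)$ is $\psi(x)-\psi(b-x)$, and each further derivative flips the second
  -- sign.
  have hV := isChain_bellPair (U := regular ∩ Set.Iio b)
    (H := fun x => Real.Gamma (1 - b) * (Real.Gamma x * Real.Gamma (b - x)))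
    (σ := fun x => Real.sin (Real.pi * (b - x)) / Real.pi)
    (τ := fun x => -Real.cos (Real.pi * (b - x))) (c := Real.pi ^ 2)
    (d := fun k x => polygamma k x + (-1) ^ (k + 1) * polygamma k (b - x))
    (fun x hx => by
      refine (((hasDerivAt_Gamma hx.1).mul (hasDerivAt_Gamma_comp (hr x hx)
        (hsub x))).const_mul _).congr_deriv ?_
      ring)
    (fun k x hx => by
      refine ((hasDerivAt_polygamma k hx.1).add (((hasDerivAt_polygamma k (hr x hx)).comp x
        (hsub x)).const_mul _)).congr_deriv ?_
      ring)
    (fun x _ => ((hpisub x).sin.div_const Real.pi).congr_deriv (by field_simp))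
    (fun x _ => (hpisub x).cos.neg.congr_deriv (by field_simp))
  have hpos : a < b := by
    have : (1 : ℝ) ≤ m := by exact_mod_cast hm
    linarith
  have := (IsChain.eqOn hU (fun n x hx => hW n x hx.1) hV (fun x hx => by
    simp only [h0 x hx.1, bellPair, betaValue_eq_sin hx.2, map_one, map_zero]
    ring) n) ⟨ha, hpos⟩
  rw [← h n hn a ha, this]
  simp only [hab]
  -- At $b-a=m$ the sine vanishes and $\tau=-(-1)^m$, so only the second component of `bellPair`
  -- remains.
  have hs : Real.sin (Real.pi * m) = 0 := by rw [mul_comm]; exact Real.sin_nat_mul_pi m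
  have hc : Real.cos (Real.pi * m) = (-1) ^ m := by rw [mul_comm]; exact Real.cos_nat_mul_pi m
  rw [hs, hc]
  ring

/-- The case in which `b = m + 1` is a positive integer. -/
theorem exists_shiftedSum_eq_of_nat {m n : ℕ} (hmn : m < n) :
    ∃ c : ℕ → Polynomial ℚ, ∀ a ∈ regular, shiftedSum (n + 1) a (m + 1) =
      ∑ j ∈ Finset.range n, Polynomial.aeval a (c j) * shiftedSum (j + 2) a 1 := by
  induction m generalizing n with
  | zero =>
    obtain ⟨n, rfl⟩ := Nat.exists_eq_succ_of_ne_zero hmn.ne'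
    refine ⟨fun j => if j = n then 1 else 0, fun a _ => ?_⟩
    rw [Finset.sum_eq_single n (fun j _ hj => by simp [hj]) (by simp)]
    simp
  | succ m ih =>
    obtain ⟨n, rfl⟩ := Nat.exists_eq_succ_of_ne_zero (Nat.ne_of_gt (m.succ_pos.trans hmn))
    obtain ⟨c, hc⟩ := ih (n := n) (by omega)
    obtain ⟨d, hd⟩ := ih (n := n + 1) (by omega)
    -- These are the coefficients of the contiguous relation at $b=m+1$; the family `c`, shorter by
    -- one, is padded with zero.
    refine ⟨fun j => Polynomial.C (1 / ((m : ℚ) + 1)) * ((if j < n then c j else 0) +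
      (Polynomial.C ((m : ℚ) + 1) - Polynomial.X) * d j), fun a ha => ?_⟩
    have hm : (m : ℝ) + 1 ≠ 0 := by positivity
    have h := shiftedSum_contiguous ha (b := m + 1) (r := n + 1) (by
      have : ((m + 1 : ℕ) : ℝ) < (n + 1 : ℕ) := by exact_mod_cast hmn
      exact_mod_cast this)
    rw [hc a ha, hd a ha] at h
    have hext : ∑ j ∈ Finset.range n, Polynomial.aeval a (c j) * shiftedSum (j + 2) a 1 =
        ∑ j ∈ Finset.range (n + 1),
          Polynomial.aeval a (if j < n then c j else 0) * shiftedSum (j + 2) a 1 := by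
      rw [Finset.sum_range_succ]
      simp only [lt_irrefl, if_false, map_zero, zero_mul, add_zero]
      refine Finset.sum_congr rfl fun j hj => ?_
      rw [if_pos (Finset.mem_range.1 hj)]
    rw [hext, Finset.mul_sum, ← Finset.sum_add_distrib] at h
    apply mul_left_cancel₀ hm
    push_cast
    rw [h, Finset.mul_sum]
    refine Finset.sum_congr rfl fun j _ => ?_
    simp only [map_mul, map_add, map_sub, Polynomial.aeval_C, Polynomial.aeval_X, map_div₀,
      map_one, map_natCast]
    field_simp

theorem shiftedSum_one_eq_polygamma (k : ℕ) {x : ℝ} (hx : x ∈ regular) :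
    shiftedSum (k + 2) x 1 = (-1) ^ k / (k + 1).factorial * polygamma (k + 1) x := by
  have h : ((k + 1).factorial : ℝ) ≠ 0 := by positivity
  have h1 : ((-1 : ℝ) ^ k) * (-1) ^ k = 1 := by rw [← mul_pow]; simp
  rw [polygamma_succ_eq k hx]
  field_simp
  linear_combination (-shiftedSum (k + 2) x 1) * h1

/-! ### Hurwitz sums, zeta and beta values, and special digamma values -/

theorem ratCast_mem (K : Subalgebra ℚ ℝ) (q : ℚ) : (q : ℝ) ∈ K := by
  simpa using K.algebraMap_mem q

theorem summable_hurwitz (x : ℝ) {s : ℕ} (hs : 2 ≤ s) :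
    Summable fun n : ℕ => 1 / (x + n) ^ s := by
  have h : (2 : ℝ) ≤ s := by exact_mod_cast hs
  simpa [coeff_one] using summable_shifted x (b := 1) (r := s) (by linarith)

theorem shiftedSum_one_right (x : ℝ) (s : ℕ) :
    shiftedSum s x 1 = ∑' n : ℕ, 1 / (x + n) ^ s := by
  simp [shiftedSum, coeff_one]

theorem hurwitz_add_one (x : ℝ) {s : ℕ} (hs : 2 ≤ s) :
    shiftedSum s x 1 = 1 / x ^ s + shiftedSum s (x + 1) 1 := by
  rw [shiftedSum_one_right, (summable_hurwitz x hs).tsum_eq_zero_add, shiftedSum_one_right]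
  simp only [Nat.cast_zero, add_zero, Nat.cast_succ]
  congr 1
  exact tsum_congr fun n => by ring_nf

theorem tsum_even_odd_of_summable {f : ℕ → ℝ} (h : Summable f) :
    ∑' n, f (2 * n) + ∑' n, f (2 * n + 1) = ∑' n, f n :=
  tsum_even_add_odd (h.comp_injective (mul_right_injective₀ two_ne_zero))
    (h.comp_injective ((add_left_injective 1).comp (mul_right_injective₀ two_ne_zero)))

theorem hurwitz_duplication (x : ℝ) {s : ℕ} (hs : 2 ≤ s) :
    shiftedSum s x 1 + shiftedSum s (x + 1 / 2) 1 = 2 ^ s * shiftedSum s (2 * x) 1 := by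
  have e0 : ∀ n : ℕ, 1 / (x + n) ^ s = 2 ^ s * (1 / (2 * x + (2 * n : ℕ)) ^ s) := fun n => by
    have : 2 * x + ((2 * n : ℕ) : ℝ) = 2 * (x + n) := by push_cast; ring
    rw [this, mul_pow]
    field_simp
  have e1 : ∀ n : ℕ, 1 / (x + 1 / 2 + n) ^ s =
      2 ^ s * (1 / (2 * x + (2 * n + 1 : ℕ)) ^ s) := fun n => by
    have : 2 * x + ((2 * n + 1 : ℕ) : ℝ) = 2 * (x + 1 / 2 + n) := by push_cast; ring
    rw [this, mul_pow]
    field_simp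
  simp only [shiftedSum_one_right]
  rw [tsum_congr e0, tsum_congr e1, tsum_mul_left, tsum_mul_left, ← mul_add,
    tsum_even_odd_of_summable (summable_hurwitz (2 * x) hs)]

theorem hurwitz_quarter_sub {s : ℕ} (hs : 2 ≤ s) :
    shiftedSum s (1 / 4) 1 - shiftedSum s (3 / 4) 1 = 4 ^ s * dirichletBeta s := by
  have e0 : ∀ n : ℕ, (-1 : ℝ) ^ (2 * n) / (2 * ((2 * n : ℕ) : ℝ) + 1) ^ s =
      (4 ^ s)⁻¹ * (1 / (1 / 4 + (n : ℝ)) ^ s) := fun n => by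
    have : 2 * ((2 * n : ℕ) : ℝ) + 1 = 4 * (1 / 4 + n) := by push_cast; ring
    rw [this, mul_pow, pow_mul]
    simp only [even_two, Even.neg_pow, one_pow]
    field_simp
  have e1 : ∀ n : ℕ, (-1 : ℝ) ^ (2 * n + 1) / (2 * ((2 * n + 1 : ℕ) : ℝ) + 1) ^ s =
      (4 ^ s)⁻¹ * -(1 / (3 / 4 + (n : ℝ)) ^ s) := fun n => by
    have : 2 * ((2 * n + 1 : ℕ) : ℝ) + 1 = 4 * (3 / 4 + n) := by push_cast; ring
    rw [this, mul_pow, pow_succ, pow_mul]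
    simp only [even_two, Even.neg_pow, one_pow]
    field_simp
  have h0 := (summable_hurwitz (1 / 4) hs).mul_left ((4 : ℝ) ^ s)⁻¹
  have h1 := (summable_hurwitz (3 / 4) hs).neg.mul_left ((4 : ℝ) ^ s)⁻¹
  rw [dirichletBeta, ← tsum_even_add_odd (h0.congr fun n => (e0 n).symm)
    (h1.congr fun n => (e1 n).symm), tsum_congr e0, tsum_congr e1, tsum_mul_left, tsum_mul_left,
    tsum_neg, shiftedSum_one_right, shiftedSum_one_right]
  field_simp
  ring

theorem hurwitz_one_eq_zeta {s : ℕ} (hs : 2 ≤ s) :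
    shiftedSum s 1 1 = (riemannZeta (s : ℂ)).re := by
  have h : riemannZeta (s : ℂ) = ((∑' n : ℕ, 1 / (n : ℝ) ^ s : ℝ) : ℂ) := by
    rw [zeta_nat_eq_tsum_of_gt_one (by omega)]
    push_cast
    rfl
  have hsum : Summable fun n : ℕ => 1 / (n : ℝ) ^ s := by
    simpa using summable_hurwitz 0 hs
  rw [h, Complex.ofReal_re, hsum.tsum_eq_zero_add, shiftedSum_one_right]
  simp only [Nat.cast_zero, Nat.cast_succ, zero_pow (show s ≠ 0 by omega), div_zero, zero_add]
  exact tsum_congr fun n => by ring_nf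

/-- Even $s$ is Euler's evaluation of $\zeta(2k)$ as a rational multiple of $\pi^{2k}$; odd $s$ is
one of the assumed members. -/
theorem hurwitz_one_mem {K : Subalgebra ℚ ℝ} (hpi : Real.pi ∈ K)
    (hζ : ∀ x ∈ oddZetaValues, x ∈ K) {s : ℕ} (hs : 2 ≤ s) : shiftedSum s 1 1 ∈ K := by
  rcases Nat.even_or_odd' s with ⟨k, rfl | rfl⟩
  · have h := hasSum_zeta_nat (k := k) (by omega)
    have e : shiftedSum (2 * k) 1 1 = ∑' n : ℕ, 1 / (n : ℝ) ^ (2 * k) := by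
      have hsum : Summable fun n : ℕ => 1 / (n : ℝ) ^ (2 * k) := h.summable
      rw [hsum.tsum_eq_zero_add, shiftedSum_one_right]
      simp only [Nat.cast_zero, Nat.cast_succ, zero_pow (show 2 * k ≠ 0 by omega), div_zero,
        zero_add]
      exact tsum_congr fun n => by ring_nf
    rw [e, h.tsum_eq]
    have : (-1 : ℝ) ^ (k + 1) * 2 ^ (2 * k - 1) * Real.pi ^ (2 * k) * bernoulli (2 * k) /
        (2 * k).factorial = (((-1 : ℚ) ^ (k + 1) * 2 ^ (2 * k - 1) * bernoulli (2 * k) /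
        (2 * k).factorial : ℚ) : ℝ) * Real.pi ^ (2 * k) := by
      push_cast
      ring
    rw [this]
    exact K.mul_mem (ratCast_mem K _) (K.pow_mem hpi _)
  · rw [hurwitz_one_eq_zeta hs]
    exact hζ _ ⟨k, by omega, rfl⟩

/-- The Fourier series of the Bernoulli polynomial $B_{2k+1}$ at $1/4$: $\sin(\pi n/2)$ is the odd
character modulo $4$, so $\beta(2k+1)$ is a rational multiple of $\pi^{2k+1}$. -/
theorem dirichletBeta_odd_mem {K : Subalgebra ℚ ℝ} (hpi : Real.pi ∈ K) {k : ℕ} (hk : k ≠ 0) :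
    dirichletBeta (2 * k + 1) ∈ K := by
  have h := hasSum_one_div_nat_pow_mul_sin hk (x := ((1 / 4 : ℚ) : ℝ)) (by norm_num)
  have e0 : ∀ n : ℕ, 1 / ((2 * n : ℕ) : ℝ) ^ (2 * k + 1) *
      Real.sin (2 * Real.pi * ((2 * n : ℕ) : ℝ) * ((1 / 4 : ℚ) : ℝ)) = 0 := fun n => by
    have : 2 * Real.pi * ((2 * n : ℕ) : ℝ) * ((1 / 4 : ℚ) : ℝ) = n * Real.pi := by
      push_cast; ring
    rw [this, Real.sin_nat_mul_pi, mul_zero]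
  have e1 : ∀ n : ℕ, 1 / ((2 * n + 1 : ℕ) : ℝ) ^ (2 * k + 1) *
      Real.sin (2 * Real.pi * ((2 * n + 1 : ℕ) : ℝ) * ((1 / 4 : ℚ) : ℝ)) =
      (-1) ^ n / (2 * (n : ℝ) + 1) ^ (2 * k + 1) := fun n => by
    have : 2 * Real.pi * ((2 * n + 1 : ℕ) : ℝ) * ((1 / 4 : ℚ) : ℝ) =
        n * Real.pi + Real.pi / 2 := by
      push_cast; ring
    rw [this, Real.sin_add_pi_div_two, Real.cos_nat_mul_pi]
    push_cast
    ring
  have h' := (tsum_even_odd_of_summable h.summable).trans h.tsum_eq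
  rw [tsum_congr e0, tsum_congr e1, tsum_zero, zero_add] at h'
  rw [dirichletBeta, h', Polynomial.eval_map]
  have e2 : Polynomial.eval₂ (algebraMap ℚ ℝ) ((1 / 4 : ℚ) : ℝ) (Polynomial.bernoulli (2 * k + 1)) =
      ((Polynomial.eval (1 / 4) (Polynomial.bernoulli (2 * k + 1)) : ℚ) : ℝ) := by
    rw [← eq_ratCast (algebraMap ℚ ℝ) (1 / 4), Polynomial.eval₂_at_apply, eq_ratCast]
  rw [e2]
  generalize Polynomial.eval (1 / 4) (Polynomial.bernoulli (2 * k + 1)) = q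
  have : (-1 : ℝ) ^ (k + 1) * (2 * Real.pi) ^ (2 * k + 1) / 2 / (2 * k + 1).factorial * q =
      (((-1 : ℚ) ^ (k + 1) * 2 ^ (2 * k + 1) / 2 / (2 * k + 1).factorial * q : ℚ) : ℝ) *
        Real.pi ^ (2 * k + 1) := by
    push_cast
    rw [mul_pow]
    ring
  rw [this]
  exact K.mul_mem (ratCast_mem K _) (K.pow_mem hpi _)

/-- Logarithmic derivative of Legendre's duplication formula. -/
theorem digamma_duplication {s : ℝ} (hs : 0 < s) :
    polygamma 0 s + polygamma 0 (s + 1 / 2) = 2 * polygamma 0 (2 * s) - 2 * Real.log 2 := by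
  have hlog : ∀ {x : ℝ}, 0 < x →
      HasDerivAt (fun y => Real.log (Real.Gamma y)) (polygamma 0 x) x := by
    intro x hx
    have hG := Gamma_ne_zero (regular_of_pos hx)
    exact ((hasDerivAt_Gamma (regular_of_pos hx)).log hG).congr_deriv
      (mul_div_cancel_left₀ _ hG)
  have h1 : HasDerivAt (fun y => Real.log (Real.Gamma y) + Real.log (Real.Gamma (y + 1 / 2)))
      (polygamma 0 s + polygamma 0 (s + 1 / 2)) s :=
    (hlog hs).add ((hlog (x := s + 1 / 2) (by linarith)).comp_add_const s (1 / 2))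
  have h2 : HasDerivAt (fun y => Real.log (Real.Gamma (2 * y)) + (1 - 2 * y) * Real.log 2 +
      Real.log (√Real.pi)) (2 * polygamma 0 (2 * s) - 2 * Real.log 2) s := by
    have hm : HasDerivAt (fun y : ℝ => 2 * y) 2 s := by simpa using (hasDerivAt_id s).const_mul 2
    have h3 := (hlog (x := 2 * s) (by linarith)).comp s hm
    refine ((h3.add ((hm.const_sub 1).mul_const (Real.log 2))).add_const _).congr_deriv ?_
    ring
  refine h1.unique (h2.congr_of_eventuallyEq ?_)
  filter_upwards [isOpen_Ioi.mem_nhds hs] with y hy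
  have hy' : 0 < y := hy
  have g1 := Real.Gamma_pos_of_pos hy'
  have g2 := Real.Gamma_pos_of_pos (show 0 < y + 1 / 2 by linarith)
  have g3 := Real.Gamma_pos_of_pos (show 0 < 2 * y by linarith)
  have hpi := Real.pi_pos
  rw [← Real.log_mul g1.ne' g2.ne', Real.Gamma_mul_Gamma_add_half,
    Real.log_mul (by positivity) (by positivity), Real.log_mul (by positivity) (by positivity),
    Real.log_rpow two_pos]

/-- Differentiating the constant $\Gamma(x)\Gamma(1-x)\sin(\pi x)=\pi$ at $1/4$, where sine and
cosine agree. -/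
theorem digamma_quarter_sub :
    polygamma 0 (1 / 4) - polygamma 0 (3 / 4) = -Real.pi := by
  have h34 : (1 : ℝ) - 1 / 4 = 3 / 4 := by norm_num
  have h1 := hasDerivAt_Gamma (regular_of_pos (show (0 : ℝ) < 1 / 4 by norm_num))
  have h2 := hasDerivAt_Gamma_comp (g := fun x => 1 - x) (x := 1 / 4)
    (regular_of_pos (by norm_num)) ((hasDerivAt_id _).const_sub 1)
  have h3 : HasDerivAt (fun x => Real.sin (Real.pi * x))
      (Real.cos (Real.pi * (1 / 4)) * (Real.pi * 1)) (1 / 4) :=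
    ((hasDerivAt_id (1 / 4 : ℝ)).const_mul Real.pi).sin
  have h := (h1.mul h2).mul h3
  have hc : (fun x => Real.Gamma x * Real.Gamma (1 - x) * Real.sin (Real.pi * x)) =ᶠ[𝓝 (1 / 4)]
      fun _ => Real.pi := by
    filter_upwards [Ioo_mem_nhds (show (0 : ℝ) < 1 / 4 by norm_num)
      (show (1 / 4 : ℝ) < 1 by norm_num)] with x hx
    have : 0 < Real.sin (Real.pi * x) := Real.sin_pos_of_pos_of_lt_pi
      (mul_pos Real.pi_pos hx.1) (by nlinarith [Real.pi_pos, hx.2])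
    rw [Real.Gamma_mul_Gamma_one_sub, div_mul_cancel₀ _ this.ne']
  have h0 := h.unique ((hasDerivAt_const _ Real.pi).congr_of_eventuallyEq hc)
  have hs : Real.sin (Real.pi * (1 / 4)) = Real.cos (Real.pi * (1 / 4)) := by
    rw [mul_one_div, Real.sin_pi_div_four, Real.cos_pi_div_four]
  have hcpos : 0 < Real.cos (Real.pi * (1 / 4)) := by
    rw [mul_one_div, Real.cos_pi_div_four]; positivity
  have g1 := Real.Gamma_pos_of_pos (show (0 : ℝ) < 1 / 4 by norm_num)
  have g2 := Real.Gamma_pos_of_pos (show (0 : ℝ) < 3 / 4 by norm_num)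
  simp only [Pi.mul_apply, h34, hs] at h0
  have h5 : (Real.Gamma (1 / 4) * Real.Gamma (3 / 4) * Real.cos (Real.pi * (1 / 4))) *
      (polygamma 0 (1 / 4) - polygamma 0 (3 / 4) + Real.pi) = 0 := by
    linear_combination h0
  have := (mul_eq_zero.1 h5).resolve_left (by positivity)
  linarith

/-! ### Polygamma and Gamma values at half- and quarter-integers -/

/-- Up to the constant `ψ(1) = -γ`, the polygamma values at `x` belong to `K`. -/
def PolygammaValuesIn (K : Subalgebra ℚ ℝ) (x : ℝ) : Prop :=
  polygamma 0 x - polygamma 0 1 ∈ K ∧ ∀ s : ℕ, 2 ≤ s → shiftedSum s x 1 ∈ K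

theorem PolygammaValuesIn.polygamma_succ_mem {K : Subalgebra ℚ ℝ} {x : ℝ}
    (h : PolygammaValuesIn K x) (hx : x ∈ regular) (k : ℕ) : polygamma (k + 1) x ∈ K := by
  rw [polygamma_succ_eq k hx]
  have := K.mul_mem (ratCast_mem K ((-1) ^ k * (k + 1).factorial)) (h.2 (k + 2) (by omega))
  push_cast at this
  exact this

theorem polygammaValuesIn_add_one {K : Subalgebra ℚ ℝ} {q : ℚ} (hq : (q : ℝ) ∈ regular) :
    PolygammaValuesIn K (q + 1) ↔ PolygammaValuesIn K q := by
  have h1 : (1 / (q : ℝ)) ∈ K := by simpa using ratCast_mem K (1 / q)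
  have h2 : ∀ s : ℕ, (1 / (q : ℝ) ^ s) ∈ K := fun s => by simpa using ratCast_mem K (1 / q ^ s)
  have e : polygamma 0 ((q : ℝ) + 1) - polygamma 0 1 = polygamma 0 q - polygamma 0 1 + 1 / q := by
    rw [digamma_add_one hq]; ring
  refine and_congr ?_ (forall_congr' fun s => forall_congr' fun hs => ?_)
  · rw [e, add_mem_cancel_right h1]
  · rw [hurwitz_add_one (q : ℝ) hs, add_mem_cancel_left (h2 s)]

theorem polygammaValuesIn_one {K : Subalgebra ℚ ℝ} (hpi : Real.pi ∈ K)
    (hζ : ∀ x ∈ oddZetaValues, x ∈ K) : PolygammaValuesIn K 1 :=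
  ⟨by rw [sub_self]; exact K.zero_mem, fun _ hs => hurwitz_one_mem hpi hζ hs⟩

theorem polygammaValuesIn_half {K : Subalgebra ℚ ℝ} (hpi : Real.pi ∈ K) (hl : Real.log 2 ∈ K)
    (hζ : ∀ x ∈ oddZetaValues, x ∈ K) : PolygammaValuesIn K (1 / 2) := by
  constructor
  · have h := digamma_duplication (s := 1 / 2) (by norm_num)
    norm_num at h
    have : polygamma 0 (1 / 2) - polygamma 0 1 = -((2 : ℚ) : ℝ) * Real.log 2 := by
      push_cast; linarith
    rw [this]
    exact K.mul_mem (K.neg_mem (ratCast_mem K 2)) hl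
  · intro s hs
    have h := hurwitz_duplication (1 / 2) hs
    norm_num at h
    have : shiftedSum s (1 / 2) 1 = ((2 ^ s - 1 : ℚ) : ℝ) * shiftedSum s 1 1 := by
      push_cast; linarith
    rw [this]
    exact K.mul_mem (ratCast_mem K _) (hurwitz_one_mem hpi hζ hs)

/-- Duplication gives the sum of the values at $1/4$ and $3/4$; reflection, or $\beta(s)$, gives
their difference. The two equations are solved over $\mathbb Q$. -/
theorem polygammaValuesIn_quarter {K : Subalgebra ℚ ℝ} (hpi : Real.pi ∈ K) (hl : Real.log 2 ∈ K)
    (hζ : ∀ x ∈ oddZetaValues, x ∈ K) (hβ : ∀ x ∈ evenBetaValues, x ∈ K) :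
    PolygammaValuesIn K (1 / 4) ∧ PolygammaValuesIn K (3 / 4) := by
  obtain ⟨hh0, hh⟩ := polygammaValuesIn_half hpi hl hζ
  have h1 := digamma_duplication (s := 1 / 4) (by norm_num)
  have h2 := digamma_quarter_sub
  norm_num at h1
  have hb : ∀ s : ℕ, 2 ≤ s → dirichletBeta s ∈ K := by
    intro s hs
    rcases Nat.even_or_odd' s with ⟨k, rfl | rfl⟩
    · exact hβ _ ⟨k, by omega, rfl⟩
    · exact dirichletBeta_odd_mem hpi (by omega)
  have hr : ∀ (q : ℚ) {x : ℝ}, x ∈ K → (q : ℝ) * x ∈ K := fun q x hx =>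
    K.mul_mem (ratCast_mem K q) hx
  have hd : ∀ s : ℕ, 2 ≤ s → shiftedSum s (1 / 4) 1 + shiftedSum s (3 / 4) 1 =
      2 ^ s * shiftedSum s (1 / 2) 1 := fun s hs => by
    have := hurwitz_duplication (1 / 4) hs
    norm_num at this
    exact this
  refine ⟨⟨?_, fun s hs => ?_⟩, ⟨?_, fun s hs => ?_⟩⟩
  · have : polygamma 0 (1 / 4) - polygamma 0 1 = (polygamma 0 (1 / 2) - polygamma 0 1) +
        (((-1 : ℚ) : ℝ) * Real.log 2 + ((-1 / 2 : ℚ) : ℝ) * Real.pi) := by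
      push_cast; linarith
    rw [this]
    exact K.add_mem hh0 (K.add_mem (hr _ hl) (hr _ hpi))
  · have h3 := hd s hs
    have h4 := hurwitz_quarter_sub hs
    have : shiftedSum s (1 / 4) 1 = ((2 ^ s / 2 : ℚ) : ℝ) * shiftedSum s (1 / 2) 1 +
        ((4 ^ s / 2 : ℚ) : ℝ) * dirichletBeta s := by
      push_cast; linarith
    rw [this]
    exact K.add_mem (hr _ (hh s hs)) (hr _ (hb s hs))
  · have : polygamma 0 (3 / 4) - polygamma 0 1 = (polygamma 0 (1 / 2) - polygamma 0 1) +
        (((-1 : ℚ) : ℝ) * Real.log 2 + ((1 / 2 : ℚ) : ℝ) * Real.pi) := by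
      push_cast; linarith
    rw [this]
    exact K.add_mem hh0 (K.add_mem (hr _ hl) (hr _ hpi))
  · have h3 := hd s hs
    have h4 := hurwitz_quarter_sub hs
    have : shiftedSum s (3 / 4) 1 = ((2 ^ s / 2 : ℚ) : ℝ) * shiftedSum s (1 / 2) 1 +
        ((-4 ^ s / 2 : ℚ) : ℝ) * dirichletBeta s := by
      push_cast; linarith
    rw [this]
    exact K.add_mem (hr _ (hh s hs)) (hr _ (hb s hs))

theorem polygammaValuesIn_nat {K : Subalgebra ℚ ℝ} (h : PolygammaValuesIn K 1) (n : ℕ) :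
    PolygammaValuesIn K (n + 1) := by
  induction n with
  | zero => simpa using h
  | succ n ih =>
    have hr : (((n + 1 : ℚ)) : ℝ) ∈ regular := regular_of_pos (by positivity)
    have := (polygammaValuesIn_add_one (K := K) hr).2 (by push_cast; exact ih)
    push_cast at this ⊢
    exact this

theorem regular_of_not_int {x : ℝ} (hx : ∀ m : ℤ, x ≠ m) : x ∈ regular :=
  regular_iff.2 fun n => by simpa using hx (-n)

theorem polygammaValuesIn_add_int {K : Subalgebra ℚ ℝ} {q : ℚ} (hq : ∀ m : ℤ, (q : ℝ) ≠ m)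
    (h : PolygammaValuesIn K q) (m : ℤ) : PolygammaValuesIn K (q + m) := by
  have hr : ∀ m : ℤ, ((q + m : ℚ) : ℝ) ∈ regular := fun m => regular_of_not_int fun k hk =>
    hq (k - m) (by push_cast at hk ⊢; linarith)
  induction m using Int.induction_on with
  | zero => simpa using h
  | succ n ih =>
    have := (polygammaValuesIn_add_one (K := K) (hr n)).2 (by push_cast; exact_mod_cast ih)
    push_cast at this ⊢
    rwa [← add_assoc]
  | pred n ih =>
    refine (by push_cast; rfl : ((q + (-n - 1 : ℤ) : ℚ) : ℝ) = q + ((-n - 1 : ℤ) : ℝ)) ▸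
      (polygammaValuesIn_add_one (K := K) (hr (-n - 1))).1 ?_
    have e : ((q + (-n - 1 : ℤ) : ℚ) : ℝ) + 1 = q + ((-n : ℤ) : ℝ) := by push_cast; ring
    rwa [e]

theorem exists_Gamma_add_nat {q : ℚ} (hq : (q : ℝ) ∈ regular) (n : ℕ) :
    ∃ c : ℚ, c ≠ 0 ∧ Real.Gamma (q + n) = c * Real.Gamma q := by
  induction n with
  | zero => exact ⟨1, one_ne_zero, by simp⟩
  | succ n ih =>
    obtain ⟨c, hc, h⟩ := ih
    have hn := hq n
    refine ⟨(q + n) * c, mul_ne_zero (by exact_mod_cast hn) hc, ?_⟩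
    push_cast
    rw [← add_assoc, Real.Gamma_add_one hn, h, mul_assoc]

theorem exists_Gamma_add_int {q : ℚ} (hq : ∀ m : ℤ, (q : ℝ) ≠ m) (m : ℤ) :
    ∃ c : ℚ, c ≠ 0 ∧ Real.Gamma (q + m) = c * Real.Gamma q := by
  obtain ⟨n, rfl | rfl⟩ := m.eq_nat_or_neg
  · simpa using exists_Gamma_add_nat (regular_of_not_int hq) n
  · have hr : ((q - n : ℚ) : ℝ) ∈ regular := regular_of_not_int fun k hk =>
      hq (k + n) (by push_cast at hk ⊢; linarith)
    obtain ⟨c, hc, h⟩ := exists_Gamma_add_nat hr n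
    refine ⟨c⁻¹, inv_ne_zero hc, ?_⟩
    have hc' : (c : ℝ) ≠ 0 := by exact_mod_cast hc
    push_cast at h ⊢
    rw [sub_add_cancel] at h
    rw [h, ← sub_eq_add_neg, inv_mul_cancel_left₀ hc']

theorem not_int_half : ∀ m : ℤ, ((1 / 2 : ℚ) : ℝ) ≠ m := fun m h => by
  have h2 : (1 : ℝ) = ((2 * m : ℤ) : ℝ) := by push_cast at h ⊢; linarith
  have : (1 : ℤ) = 2 * m := by exact_mod_cast h2
  omega

theorem exists_Gamma_half {x : ℝ} {p : ℤ} (hp : 2 * x = p) (hx : ∀ m : ℤ, x ≠ m) :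
    ∃ c : ℚ, c ≠ 0 ∧ Real.Gamma x = c * √Real.pi := by
  obtain ⟨k, rfl | rfl⟩ := Int.even_or_odd' p
  · exact absurd (by push_cast at hp; linarith) (hx k)
  · obtain ⟨c, hc, h⟩ := exists_Gamma_add_int not_int_half k
    refine ⟨c, hc, ?_⟩
    have e : x = ((1 / 2 : ℚ) : ℝ) + k := by push_cast at hp ⊢; linarith
    rw [e, h]
    push_cast
    rw [Real.Gamma_one_half_eq]

theorem eq_nat_of_regular_int {x : ℝ} (hx : x ∈ regular) {m : ℤ} (h : x = m) :
    ∃ n : ℕ, x = n + 1 := by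
  rcases lt_or_ge 0 m with hm | hm
  · refine ⟨(m - 1).toNat, ?_⟩
    have : ((m - 1).toNat : ℤ) = m - 1 := Int.toNat_of_nonneg (by omega)
    have : ((m - 1).toNat : ℝ) = m - 1 := by exact_mod_cast this
    rw [h, this]
    ring
  · refine absurd ?_ (hx (-m).toNat)
    have : ((-m).toNat : ℤ) = -m := Int.toNat_of_nonneg (by omega)
    have : ((-m).toNat : ℝ) = -m := by exact_mod_cast this
    rw [h, this]
    ring

theorem polygammaValuesIn_levelTwo {x : ℝ} (hx : x ∈ regular) {p : ℤ} (hp : 2 * x = p)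
    {K : Subalgebra ℚ ℝ} (hpi : Real.pi ∈ K) (hl : Real.log 2 ∈ K)
    (hζ : ∀ x ∈ oddZetaValues, x ∈ K) : PolygammaValuesIn K x := by
  obtain ⟨k, rfl | rfl⟩ := Int.even_or_odd' p
  · obtain ⟨n, rfl⟩ := eq_nat_of_regular_int hx (m := k) (by push_cast at hp; linarith)
    exact polygammaValuesIn_nat (polygammaValuesIn_one hpi hζ) n
  · have e : x = ((1 / 2 : ℚ) : ℝ) + k := by push_cast at hp ⊢; linarith
    rw [e]
    refine polygammaValuesIn_add_int not_int_half ?_ k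
    push_cast
    exact polygammaValuesIn_half hpi hl hζ

theorem polygammaValuesIn_levelFour {x : ℝ} (hx : x ∈ regular) {p : ℤ} (hp : 4 * x = p)
    {K : Subalgebra ℚ ℝ} (hpi : Real.pi ∈ K) (hl : Real.log 2 ∈ K)
    (hζ : ∀ x ∈ oddZetaValues, x ∈ K) (hβ : ∀ x ∈ evenBetaValues, x ∈ K) :
    PolygammaValuesIn K x := by
  obtain ⟨h1, h3⟩ := polygammaValuesIn_quarter hpi hl hζ hβ
  have hn : ∀ q : ℚ, (q = 1 / 4 ∨ q = 3 / 4) → ∀ m : ℤ, (q : ℝ) ≠ m := by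
    rintro q hq m h
    have h' : q = m := by exact_mod_cast h
    rcases hq with rfl | rfl
    · have h2 : (1 : ℚ) = ((4 * m : ℤ) : ℚ) := by push_cast; linarith
      have : (1 : ℤ) = 4 * m := by exact_mod_cast h2
      omega
    · have h2 : (3 : ℚ) = ((4 * m : ℤ) : ℚ) := by push_cast; linarith
      have : (3 : ℤ) = 4 * m := by exact_mod_cast h2
      omega
  obtain ⟨k, rfl | rfl⟩ := Int.even_or_odd' p
  · exact polygammaValuesIn_levelTwo hx (p := k) (by push_cast at hp; linarith) hpi hl hζ
  · obtain ⟨l, rfl | rfl⟩ := Int.even_or_odd' k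
    · have e : x = ((1 / 4 : ℚ) : ℝ) + l := by push_cast at hp ⊢; linarith
      rw [e]
      exact polygammaValuesIn_add_int (hn _ (Or.inl rfl)) (by push_cast; exact h1) l
    · have e : x = ((3 / 4 : ℚ) : ℝ) + l := by push_cast at hp ⊢; linarith
      rw [e]
      exact polygammaValuesIn_add_int (hn _ (Or.inr rfl)) (by push_cast; exact h3) l

/-! ### From the hypergeometric series to shifted sums -/

theorem ascPochhammer_mul_add (a : ℝ) (n : ℕ) :
    (ascPochhammer ℝ n).eval a * (a + n) = a * (ascPochhammer ℝ n).eval (a + 1) := by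
  rw [← ascPochhammer_succ_eval, ascPochhammer_succ_left]
  simp

theorem hypergeometricTerm_eq {r : ℕ} {a : ℝ} (b : ℝ) (ha : a ∈ regular) (n : ℕ) :
    hypergeometricTerm (upperParams r a b) (lowerParams r a) 1 n =
      a ^ r * (coeff b n / (a + n) ^ r) := by
  have h1 : (ascPochhammer ℝ n).eval (a + 1) ≠ 0 := by
    rw [eval_ascPochhammer]
    exact Finset.prod_ne_zero_iff.2 fun j _ => regular_add_one ha j
  have h2 : (ascPochhammer ℝ n).eval a =
      a / (a + n) * (ascPochhammer ℝ n).eval (a + 1) := by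
    have := ascPochhammer_mul_add a n
    have h0 := ha n
    field_simp
    linarith
  simp only [hypergeometricTerm, upperParams, lowerParams, coeff, List.map_append,
    List.map_replicate, List.map_cons, List.map_nil, List.prod_append, List.prod_replicate,
    List.prod_cons, List.prod_nil, mul_one, one_pow]
  rw [h2, mul_pow, div_pow]
  have h0 := ha n
  field_simp

theorem hypergeometricValue_eq {r : ℕ} {a : ℝ} (b : ℝ) (ha : a ∈ regular) :
    hypergeometricValue (upperParams r a b) (lowerParams r a) 1 = a ^ r * shiftedSum r a b := by
  rw [hypergeometricValue, shiftedSum, ← tsum_mul_left]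
  exact tsum_congr (hypergeometricTerm_eq b ha)

theorem hypergeometricValue_zero {r : ℕ} (hr : 1 ≤ r) (b : ℝ) :
    hypergeometricValue (upperParams r 0 b) (lowerParams r 0) 1 = 1 := by
  rw [hypergeometricValue, tsum_eq_single 0]
  · simp [hypergeometricTerm]
  · intro n hn
    have h : (ascPochhammer ℝ n).eval 0 = 0 := ascPochhammer_ne_zero_eval_zero ℝ hn
    have hr' : r ≠ 0 := by omega
    simp [hypergeometricTerm, upperParams, h, hr']

theorem regular_and_lt_of_converges {r : ℕ} (hr : 1 ≤ r) {a b : ℝ}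
    (h : HypergeometricConverges (upperParams r a b) (lowerParams r a) 1) (ha : a ≠ 0) :
    a ∈ regular ∧ b < r := by
  have hreg : a ∈ regular := regular_of_add_one ha <| regular_iff.2 <|
    h.1 (a + 1) (List.mem_replicate.2 ⟨by omega, rfl⟩)
  refine ⟨hreg, lt_of_summable_shifted (a := a) hr ?_⟩
  have := h.2
  rw [funext (hypergeometricTerm_eq b hreg)] at this
  exact (summable_mul_left_iff (pow_ne_zero r ha)).1 this

/-! ### Universal polynomials in polygamma values -/

theorem polygammaEval_aeval {d : ℕ} (x : Fin d → ℝ) (c : MvPolynomial (Fin d × ℕ) ℚ)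
    (f : ℕ → MvPolynomial (Fin d × ℕ) ℚ) (P : MvPolynomial (Option ℕ) ℚ) :
    polygammaEval x (MvPolynomial.aeval (fun i : Option ℕ => i.elim c f) P) =
      bellEval (polygammaEval x c) (fun k => polygammaEval x (f k)) P := by
  rw [polygammaEval, MvPolynomial.comp_aeval_apply, bellEval]
  congr 2
  funext i
  cases i <;> rfl

theorem exists_polynomial_generic (n : ℕ) :
    ∃ P : MvPolynomial (Fin 2 × ℕ) ℚ, ∀ a b : ℝ, a ∈ regular → (∀ m : ℕ, b ≠ m + 1) →
      a + 1 - b ∈ regular → b < n + 1 →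
      a ^ (n + 1) * shiftedSum (n + 1) a b =
        a ^ n * (Real.Gamma (a + 1) * Real.Gamma (1 - b) / Real.Gamma (a + 1 - b)) *
          polygammaEval ![a, a + 1 - b] P := by
  refine ⟨MvPolynomial.aeval (fun i : Option ℕ =>
    i.elim 0 fun k => MvPolynomial.X (0, k) - MvPolynomial.X (1, k)) (bellPair n).1,
    fun a b ha hb hab hn => ?_⟩
  rw [polygammaEval_aeval, shiftedSum_eq_generic ha hb hab hn, betaValue,
    Real.Gamma_add_one (regular_ne_zero ha)]
  simp only [polygammaEval, map_zero, map_sub, MvPolynomial.aeval_X, Matrix.cons_val_zero,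
    Matrix.cons_val_one]
  ring

/-- Expresses the $\pi^2$ coming from reflection as $6\psi'(1)$, which is the only reason for the
third argument $1$ in $Q$. -/
theorem polygamma_one_one : polygamma 1 1 = Real.pi ^ 2 / 6 := by
  have h := polygamma_succ_eq 0 one_regular
  have e : shiftedSum 2 1 1 = ∑' n : ℕ, 1 / (n : ℝ) ^ 2 := by
    rw [hasSum_zeta_two.summable.tsum_eq_zero_add, shiftedSum_one_right]
    simp only [Nat.cast_zero, Nat.cast_succ, zero_pow two_ne_zero, div_zero, zero_add]
    exact tsum_congr fun n => by ring_nf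
  rw [e, hasSum_zeta_two.tsum_eq] at h
  simpa using h

theorem exists_polynomial_of_sub_eq_nat (n : ℕ) :
    ∃ Q : MvPolynomial (Fin 3 × ℕ) ℚ, ∀ (a b : ℝ) (m : ℕ), a ∈ regular → 1 ≤ m → b - a = m →
      (∀ k : ℕ, b ≠ k + 1) → b < n + 1 →
      a ^ (n + 1) * shiftedSum (n + 1) a b = (-1) ^ m * a ^ n *
        (Real.Gamma (a + 1) * Real.Gamma (1 - b) * Real.Gamma (b - a)) *
          polygammaEval ![a, b - a, 1] Q := by
  refine ⟨MvPolynomial.aeval (fun i : Option ℕ =>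
    i.elim (MvPolynomial.C 6 * MvPolynomial.X (2, 1)) fun k =>
      MvPolynomial.X (0, k) + MvPolynomial.C ((-1) ^ (k + 1)) * MvPolynomial.X (1, k))
      (-(bellPair n).2), fun a b m ha hm hab hb hn => ?_⟩
  rw [polygammaEval_aeval, shiftedSum_eq_of_sub_eq_nat ha hb hm hab hn,
    Real.Gamma_add_one (regular_ne_zero ha)]
  have h6 : polygammaEval ![a, b - a, 1] (MvPolynomial.C 6 * MvPolynomial.X (2, 1)) =
      Real.pi ^ 2 := by
    simp [polygammaEval, polygamma_one_one]
    ring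
  have hd : ∀ k : ℕ, polygammaEval ![a, b - a, 1] (MvPolynomial.X (0, k) +
      MvPolynomial.C ((-1) ^ (k + 1)) * MvPolynomial.X (1, k)) =
      polygamma k a + (-1) ^ (k + 1) * polygamma k (b - a) := fun k => by
    simp [polygammaEval]
  simp only [h6, hd, map_neg]
  ring

theorem exists_polynomials_of_nat (n m : ℕ) :
    ∃ c : Fin (n + 1) → Polynomial ℚ, ∀ a : ℝ, a ∈ regular → m < n →
      shiftedSum (n + 1) a (m + 1) = ∑ j : Fin (n + 1), Polynomial.aeval a (c j) * polygamma j a := by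
  by_cases hmn : m < n
  · obtain ⟨c, hc⟩ := exists_shiftedSum_eq_of_nat hmn
    -- The coefficient of $\psi$ itself is zero: the sums at $b=1$ yield only $\psi^{(j+1)}$.
    refine ⟨Fin.cons 0 fun j => Polynomial.C ((-1 : ℚ) ^ (j : ℕ) / ((j : ℕ) + 1).factorial) * c j,
      fun a ha _ => ?_⟩
    rw [hc a ha, Fin.sum_univ_succ, ← Fin.sum_univ_eq_sum_range
      (fun j => Polynomial.aeval a (c j) * shiftedSum (j + 2) a 1)]
    simp only [Fin.cons_zero, map_zero, zero_mul, zero_add, Fin.cons_succ, Fin.val_succ]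
    refine Finset.sum_congr rfl fun j _ => ?_
    rw [shiftedSum_one_eq_polygamma _ ha]
    simp
    ring
  -- Coefficients must exist for every $m$, even when no series converges; then any choice serves.
  · exact ⟨0, fun a _ h => absurd h hmn⟩

/-! ### Membership in the rings -/

theorem bellEval_mem {K : Subalgebra ℚ ℝ} {c : ℝ} {d : ℕ → ℝ} (hc : c ∈ K) (hd : ∀ k, d k ∈ K)
    (P : MvPolynomial (Option ℕ) ℚ) : bellEval c d P ∈ K := by
  have h : (bellEval c d).range ≤ K := by
    rw [bellEval, MvPolynomial.aeval_range, Algebra.adjoin_le_iff]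
    rintro _ ⟨i, rfl⟩
    cases i
    · exact hc
    · exact hd _
  exact h ⟨P, rfl⟩

/-- `PolygammaValuesIn` controls $\psi$ only modulo $\psi(1)$, which cancels in the difference at
$k=0$. -/
theorem bellEval_sub_mem {K : Subalgebra ℚ ℝ} {x y : ℝ} (hx : x ∈ regular) (hy : y ∈ regular)
    (hKx : PolygammaValuesIn K x) (hKy : PolygammaValuesIn K y) (P : MvPolynomial (Option ℕ) ℚ) :
    bellEval 0 (fun k => polygamma k x - polygamma k y) P ∈ K := by
  refine bellEval_mem K.zero_mem (fun k => ?_) P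
  cases k with
  | zero => simpa using K.sub_mem hKx.1 hKy.1
  | succ k => exact K.sub_mem (hKx.polygamma_succ_mem hx k) (hKy.polygamma_succ_mem hy k)

theorem bellEval_reflection_mem {K : Subalgebra ℚ ℝ} (hpi : Real.pi ∈ K) {x y : ℝ}
    (hx : x ∈ regular) (hy : y ∈ regular)
    (hKx : PolygammaValuesIn K x) (hKy : PolygammaValuesIn K y) (P : MvPolynomial (Option ℕ) ℚ) :
    bellEval (Real.pi ^ 2) (fun k => polygamma k x + (-1) ^ (k + 1) * polygamma k y) P ∈ K := by
  refine bellEval_mem (K.pow_mem hpi 2) (fun k => ?_) P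
  cases k with
  | zero =>
    have := K.sub_mem hKx.1 hKy.1
    rw [sub_sub_sub_cancel_right] at this
    simpa [← sub_eq_add_neg] using this
  | succ k =>
    exact K.add_mem (hKx.polygamma_succ_mem hx k)
      (K.mul_mem (K.pow_mem (K.neg_mem K.one_mem) _) (hKy.polygamma_succ_mem hy k))

theorem polynomial_aeval_rat_mem (K : Subalgebra ℚ ℝ) (q : ℚ) (P : Polynomial ℚ) :
    Polynomial.aeval (q : ℝ) P ∈ K := by
  rw [← eq_ratCast (algebraMap ℚ ℝ) q, Polynomial.aeval_algebraMap_apply]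
  exact K.algebraMap_mem _

theorem shiftedSum_mem_of_nat {K : Subalgebra ℚ ℝ} {q : ℚ} (hq : (q : ℝ) ∈ regular)
    (hK : PolygammaValuesIn K q) {m n : ℕ} (hmn : m < n) :
    shiftedSum (n + 1) q (m + 1) ∈ K := by
  obtain ⟨c, hc⟩ := exists_shiftedSum_eq_of_nat hmn
  rw [hc _ hq]
  exact K.sum_mem fun j _ => K.mul_mem (polynomial_aeval_rat_mem K q _) (hK.2 _ (by omega))

theorem shiftedSum_mem_of_betaValue {K : Subalgebra ℚ ℝ} {a b : ℝ} {n : ℕ} (ha : a ∈ regular)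
    (hb : ∀ m : ℕ, b ≠ m + 1) (hab : a + 1 - b ∈ regular) (hn : b < n + 1)
    (hKa : PolygammaValuesIn K a) (hKab : PolygammaValuesIn K (a + 1 - b))
    (hβ : betaValue a b ∈ K) : shiftedSum (n + 1) a b ∈ K := by
  rw [shiftedSum_eq_generic ha hb hab hn]
  exact K.mul_mem hβ (bellEval_sub_mem ha hab hKa hKab _)

theorem exists_nat_sub_of_not_regular {a b : ℝ} (h : a + 1 - b ∉ regular) :
    ∃ k : ℕ, b - a = (k + 1 : ℕ) := by
  obtain ⟨k, hk⟩ := exists_of_not_regular h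
  exact ⟨k, by push_cast; linarith⟩

theorem exists_rat_of_mul_eq {N : ℕ} (hN : N ≠ 0) {x : ℝ} {p : ℤ} (h : N * x = p) :
    ∃ q : ℚ, x = q := by
  have hN' : (N : ℝ) ≠ 0 := by exact_mod_cast hN
  refine ⟨p / N, ?_⟩
  push_cast
  rw [eq_div_iff hN', ← h, mul_comm]

/-- The case in which `a` or `b` is an integer, for parameters in `(1/N) ℤ`. -/
theorem shiftedSum_mem_of_int {K : Subalgebra ℚ ℝ} {N : ℕ} (hN : N ≠ 0)
    (hK : ∀ x ∈ regular, (∃ p : ℤ, N * x = p) → PolygammaValuesIn K x) {a b : ℝ}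
    (ha : a ∈ regular) {n : ℕ} (hn : b < n + 1) {p q : ℤ} (hp : N * a = p) (hq : N * b = q)
    (hint : (∃ m : ℤ, a = m) ∨ ∃ m : ℤ, b = m) : shiftedSum (n + 1) a b ∈ K := by
  obtain ⟨a', rfl⟩ := exists_rat_of_mul_eq hN hp
  obtain ⟨b', rfl⟩ := exists_rat_of_mul_eq hN hq
  have hKa := hK _ ha ⟨p, hp⟩
  by_cases hb : ∀ m : ℕ, (b' : ℝ) ≠ m + 1
  swap
  · push Not at hb
    obtain ⟨m, hm⟩ := hb
    rw [hm] at hn ⊢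
    exact shiftedSum_mem_of_nat ha hKa (by exact_mod_cast (add_lt_add_iff_right 1).1 hn)
  have hb1 : ((1 - b' : ℚ) : ℝ) ∈ regular := fun k hk => hb k (by push_cast at hk; linarith)
  -- A regular integer $a$ is positive, and an integer $b$ that is not positive makes $1-b$
  -- positive. In either case one Gamma value is a factorial and the other two differ by an integer
  -- shift, so the beta value is rational and $a+1-b$ is regular.
  obtain ⟨hab, hβ⟩ : (a' : ℝ) + 1 - b' ∈ regular ∧ betaValue a' b' ∈ K := by
    rcases hint with ⟨m, hm⟩ | ⟨m, hm⟩
    · obtain ⟨k, hk⟩ := eq_nat_of_regular_int ha hm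
      obtain ⟨c, hc, h⟩ := exists_Gamma_add_nat hb1 (k + 1)
      have e : (a' : ℝ) + 1 - b' = ((1 - b' : ℚ) : ℝ) + (k + 1 : ℕ) := by
        push_cast; linarith
      refine ⟨e ▸ regular_add_nat hb1 (k + 1), ?_⟩
      have hG := Gamma_ne_zero hb1
      have hc' : (c : ℝ) ≠ 0 := by exact_mod_cast hc
      have : betaValue a' b' = ((k.factorial / c : ℚ) : ℝ) := by
        rw [betaValue, e, h, hk, Real.Gamma_nat_eq_factorial]
        push_cast at hG ⊢
        field_simp
      rw [this]
      exact ratCast_mem K _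
    · obtain ⟨k, hk⟩ := eq_nat_of_regular_int hb1 (m := 1 - m) (by push_cast; rw [hm])
      obtain ⟨c, hc, h⟩ := exists_Gamma_add_nat ha (k + 1)
      push_cast at hk
      have e : (a' : ℝ) + 1 - b' = a' + (k + 1 : ℕ) := by push_cast; linarith
      refine ⟨e ▸ regular_add_nat ha (k + 1), ?_⟩
      have hG := Gamma_ne_zero ha
      have hc' : (c : ℝ) ≠ 0 := by exact_mod_cast hc
      have : betaValue a' b' = ((k.factorial / c : ℚ) : ℝ) := by
        rw [betaValue, e, h, hk, Real.Gamma_nat_eq_factorial]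
        push_cast
        field_simp
      rw [this]
      exact ratCast_mem K _
  exact shiftedSum_mem_of_betaValue ha hb hab hn hKa
    (hK _ hab ⟨p + N - q, by push_cast; linarith⟩) hβ

/-- Outside the integer case both parameters are half-odd, so $\Gamma(a)\Gamma(1-b)$ is a rational
multiple of $\sqrt\pi\cdot\sqrt\pi=\pi$. As $b-a$ is an integer, the remaining Gamma value, at
$a+1-b$ or $b-a$, is a factorial. -/
theorem shiftedSum_mem_of_half {K : Subalgebra ℚ ℝ} (hpi : Real.pi ∈ K)
    (hK : ∀ x ∈ regular, (∃ p : ℤ, ((2 : ℕ) : ℝ) * x = p) → PolygammaValuesIn K x) {a b : ℝ}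
    (ha : a ∈ regular) {n : ℕ} (hn : b < n + 1) {p q : ℤ} (hp : 2 * a = p) (hq : 2 * b = q) :
    shiftedSum (n + 1) a b ∈ K := by
  by_cases hint : (∃ m : ℤ, a = m) ∨ ∃ m : ℤ, b = m
  · exact shiftedSum_mem_of_int two_ne_zero hK ha hn (by exact_mod_cast hp) (by exact_mod_cast hq)
      hint
  push Not at hint
  obtain ⟨hai, hbi⟩ := hint
  have hb : ∀ m : ℕ, b ≠ m + 1 := fun m hm => hbi (m + 1) (by push_cast; exact hm)
  obtain ⟨c, -, hc⟩ := exists_Gamma_half hp hai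
  obtain ⟨d, -, hd⟩ := exists_Gamma_half (x := 1 - b) (p := 2 - q) (by push_cast; linarith)
    fun m hm => hbi (1 - m) (by push_cast; linarith)
  have hKa := hK a ha ⟨p, by exact_mod_cast hp⟩
  have hpi2 := Real.mul_self_sqrt Real.pi_pos.le
  have hsub : ∃ m : ℤ, b - a = m := by
    obtain ⟨k, rfl | rfl⟩ := Int.even_or_odd' p
    · exact absurd (by push_cast at hp; linarith) (hai k)
    · obtain ⟨l, rfl | rfl⟩ := Int.even_or_odd' q
      · exact absurd (by push_cast at hq; linarith) (hbi l)
      · exact ⟨l - k, by push_cast at hp hq ⊢; linarith⟩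
  obtain ⟨m, hm⟩ := hsub
  by_cases hab : a + 1 - b ∈ regular
  · refine shiftedSum_mem_of_betaValue ha hb hab hn hKa
      (hK _ hab ⟨p + 2 - q, by push_cast; linarith⟩) ?_
    obtain ⟨k, hk⟩ := eq_nat_of_regular_int hab (m := 1 - m) (by push_cast; linarith)
    have : betaValue a b = ((c * d / k.factorial : ℚ) : ℝ) * Real.pi := by
      rw [betaValue, hc, hd, hk, Real.Gamma_nat_eq_factorial]
      push_cast
      linear_combination (c * d / k.factorial : ℝ) * hpi2
    rw [this]
    exact K.mul_mem (ratCast_mem K _) hpi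
  · obtain ⟨k, hk⟩ := exists_nat_sub_of_not_regular hab
    have hreg : b - a ∈ regular := by rw [hk]; exact regular_of_pos (by positivity)
    rw [shiftedSum_eq_of_sub_eq_nat ha hb (by omega) hk hn]
    refine K.mul_mem (K.mul_mem (K.pow_mem (K.neg_mem K.one_mem) _) ?_)
      (K.neg_mem (bellEval_reflection_mem hpi ha hreg hKa
        (hK _ hreg ⟨q - p, by push_cast; linarith⟩) _))
    have : Real.Gamma a * Real.Gamma (1 - b) * Real.Gamma (b - a) =
        ((c * d * k.factorial : ℚ) : ℝ) * Real.pi := by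
      rw [hc, hd, hk, Nat.cast_succ, Real.Gamma_nat_eq_factorial]
      push_cast
      linear_combination (c * d * k.factorial : ℝ) * hpi2
    rw [this]
    exact K.mul_mem (ratCast_mem K _) hpi

theorem polygammaValuesIn_levelTwoRing {x : ℝ} (hx : x ∈ regular)
    (h : ∃ p : ℤ, ((2 : ℕ) : ℝ) * x = p) : PolygammaValuesIn levelTwoRing x := by
  obtain ⟨p, hp⟩ := h
  exact polygammaValuesIn_levelTwo hx (by exact_mod_cast hp)
    (Algebra.subset_adjoin (by simp)) (Algebra.subset_adjoin (by simp))
    fun y hy => Algebra.subset_adjoin (by simp [hy])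

theorem polygammaValuesIn_levelFourRing {x : ℝ} (hx : x ∈ regular)
    (h : ∃ p : ℤ, ((4 : ℕ) : ℝ) * x = p) : PolygammaValuesIn levelFourRing x := by
  obtain ⟨p, hp⟩ := h
  exact polygammaValuesIn_levelFour hx (by exact_mod_cast hp)
    (Algebra.subset_adjoin (by simp)) (Algebra.subset_adjoin (by simp))
    (fun y hy => Algebra.subset_adjoin (by simp [hy]))
    fun y hy => Algebra.subset_adjoin (by simp [hy])

theorem pi_mem_levelTwoRing : Real.pi ∈ levelTwoRing := Algebra.subset_adjoin (by simp)

theorem pi_mem_levelFourRing : Real.pi ∈ levelFourRing := Algebra.subset_adjoin (by simp)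

end BetaSeries

end

/-! ### Assembly of the theorem -/

open BetaSeries

theorem lemma1 (r : ℕ) (hr : 1 ≤ r) :
    -- generic parameters
    (∃ P : MvPolynomial (Fin 2 × ℕ) ℚ, ∀ a b : ℝ,
      HypergeometricConverges (upperParams r a b) (lowerParams r a) 1 →
      a ≠ 0 → (∀ m : ℕ, b ≠ m + 1) → (∀ m : ℕ, a + 1 - b ≠ -(m : ℝ)) →
      hypergeometricValue (upperParams r a b) (lowerParams r a) 1 =
        a ^ (r - 1) * (Real.Gamma (a + 1) * Real.Gamma (1 - b) / Real.Gamma (a + 1 - b)) *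
          polygammaEval ![a, a + 1 - b] P) ∧
    -- `b - a` is a positive integer and `b` is not
    (∃ Q : MvPolynomial (Fin 3 × ℕ) ℚ, ∀ (a b : ℝ) (m : ℕ),
      HypergeometricConverges (upperParams r a b) (lowerParams r a) 1 →
      1 ≤ m → b - a = m → (∀ k : ℕ, b ≠ k + 1) →
      hypergeometricValue (upperParams r a b) (lowerParams r a) 1 =
        (-1) ^ m * a ^ (r - 1) *
          (Real.Gamma (a + 1) * Real.Gamma (1 - b) * Real.Gamma (b - a)) *
          polygammaEval ![a, b - a, 1] Q) ∧
    -- `b` is a positive integer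
    (∀ m : ℕ, 1 ≤ m → ∃ c : Fin r → Polynomial ℚ, ∀ a : ℝ,
      HypergeometricConverges (upperParams r a m) (lowerParams r a) 1 → a ≠ 0 →
      hypergeometricValue (upperParams r a m) (lowerParams r a) 1 =
        a ^ r * ∑ j : Fin r, Polynomial.aeval a (c j) * polygamma j a) ∧
    -- `a = 0`
    (∀ b : ℝ, hypergeometricValue (upperParams r 0 b) (lowerParams r 0) 1 = 1) ∧
    -- half-integral parameters
    (∀ a b : ℝ, HypergeometricConverges (upperParams r a b) (lowerParams r a) 1 →
      (∃ p : ℤ, 2 * a = p) → (∃ q : ℤ, 2 * b = q) →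
      hypergeometricValue (upperParams r a b) (lowerParams r a) 1 ∈ levelTwoRing) ∧
    -- quarter-integral parameters
    (∀ a b : ℝ, HypergeometricConverges (upperParams r a b) (lowerParams r a) 1 →
      (∃ p : ℤ, 4 * a = p) → (∃ q : ℤ, 4 * b = q) →
      (((∃ m : ℤ, a = m) ∨ ∃ m : ℤ, b = m) →
        hypergeometricValue (upperParams r a b) (lowerParams r a) 1 ∈ levelFourRing) ∧
      ((∀ m : ℤ, b ≠ m) → (∀ m : ℕ, a + 1 - b ≠ -(m : ℝ)) →
        ∃ x ∈ levelFourRing, hypergeometricValue (upperParams r a b) (lowerParams r a) 1 =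
          Real.Gamma (a + 1) * Real.Gamma (1 - b) / Real.Gamma (a + 1 - b) * x) ∧
      ((∀ m : ℤ, b ≠ m) → (∃ m : ℕ, a + 1 - b = -(m : ℝ)) →
        ∃ x ∈ levelFourRing, hypergeometricValue (upperParams r a b) (lowerParams r a) 1 =
          Real.Gamma (a + 1) * Real.Gamma (1 - b) * x)) := by
  obtain ⟨n, rfl⟩ : ∃ n, r = n + 1 := ⟨r - 1, by omega⟩
  have hval : ∀ {a b : ℝ}, HypergeometricConverges (upperParams (n + 1) a b)
      (lowerParams (n + 1) a) 1 → a ≠ 0 → a ∈ regular ∧ b < n + 1 ∧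
      hypergeometricValue (upperParams (n + 1) a b) (lowerParams (n + 1) a) 1 =
        a ^ (n + 1) * shiftedSum (n + 1) a b := fun {a b} h ha => by
    obtain ⟨h1, h2⟩ := regular_and_lt_of_converges hr h ha
    exact ⟨h1, by exact_mod_cast h2, hypergeometricValue_eq b h1⟩
  refine ⟨?_, ?_, ?_, fun b => hypergeometricValue_zero hr b, ?_, ?_⟩
  · obtain ⟨P, hP⟩ := exists_polynomial_generic n
    refine ⟨P, fun a b h ha hb hab => ?_⟩
    obtain ⟨h1, h2, h3⟩ := hval h ha
    rw [h3, hP a b h1 hb (regular_iff.2 hab) h2, Nat.add_sub_cancel]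
  · obtain ⟨Q, hQ⟩ := exists_polynomial_of_sub_eq_nat n
    refine ⟨Q, fun a b m h hm hab hb => ?_⟩
    -- If $a=0$, then $b=m$ would be a positive integer.
    have ha : a ≠ 0 := by
      rintro rfl
      obtain ⟨k, rfl⟩ := Nat.exists_eq_succ_of_ne_zero (Nat.ne_of_gt hm)
      exact hb k (by rw [sub_zero] at hab; rw [hab]; push_cast; rfl)
    obtain ⟨h1, h2, h3⟩ := hval h ha
    rw [h3, hQ a b m h1 hm hab hb h2, Nat.add_sub_cancel]
  · intro m hm
    obtain ⟨k, rfl⟩ := Nat.exists_eq_succ_of_ne_zero (Nat.ne_of_gt hm)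
    obtain ⟨c, hc⟩ := exists_polynomials_of_nat n k
    refine ⟨c, fun a h ha => ?_⟩
    obtain ⟨h1, h2, h3⟩ := hval h ha
    rw [h3, ← hc a h1 (by
      have : ((k + 1 : ℕ) : ℝ) < (n + 1 : ℕ) := by exact_mod_cast h2
      have := Nat.cast_lt.1 this
      omega)]
    push_cast
    rfl
  · rintro a b h ⟨p, hp⟩ ⟨q, hq⟩
    by_cases ha : a = 0
    · rw [ha, hypergeometricValue_zero hr]
      exact levelTwoRing.one_mem
    obtain ⟨h1, h2, h3⟩ := hval h ha
    obtain ⟨a', rfl⟩ := exists_rat_of_mul_eq (N := 2) two_ne_zero (x := a) (by exact_mod_cast hp)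
    rw [h3]
    exact levelTwoRing.mul_mem (levelTwoRing.pow_mem (ratCast_mem _ a') _)
      (shiftedSum_mem_of_half pi_mem_levelTwoRing (fun x hx => polygammaValuesIn_levelTwoRing hx)
        h1 h2 hp hq)
  · rintro a b h ⟨p, hp⟩ ⟨q, hq⟩
    have hq' : (((4 : ℕ) : ℝ)) * b = q := by exact_mod_cast hq
    have hp' : (((4 : ℕ) : ℝ)) * a = p := by exact_mod_cast hp
    by_cases ha : a = 0
    · subst ha
      rw [hypergeometricValue_zero hr]
      -- At $a=0$ the series is $1$ and the Gamma quotient is also $1$; the degenerate case would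
      -- force $b$ to be an integer.
      refine ⟨fun _ => levelFourRing.one_mem, fun hb _ => ⟨1, levelFourRing.one_mem, ?_⟩,
        fun hb hab => ?_⟩
      · have hreg : 1 - b ∈ regular := regular_of_not_int fun m hm =>
          hb (1 - m) (by push_cast; linarith)
        rw [zero_add, Real.Gamma_one, one_mul, mul_one, div_self (Gamma_ne_zero hreg)]
      · obtain ⟨m, hm⟩ := hab
        exact absurd (by push_cast; linarith) (hb (m + 1))
    obtain ⟨h1, h2, h3⟩ := hval h ha
    have hKa := polygammaValuesIn_levelFourRing h1 ⟨p, hp'⟩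
    obtain ⟨a', rfl⟩ := exists_rat_of_mul_eq (N := 4) four_ne_zero hp'
    have hpow : ∀ k : ℕ, (a' : ℝ) ^ k ∈ levelFourRing := fun k =>
      levelFourRing.pow_mem (ratCast_mem _ a') k
    rw [h3]
    refine ⟨fun hint => levelFourRing.mul_mem (hpow _) (shiftedSum_mem_of_int four_ne_zero
      (fun x hx => polygammaValuesIn_levelFourRing hx) h1 h2 hp' hq' hint),
      fun hb hab => ?_, fun hb hab => ?_⟩
    · have hb' : ∀ m : ℕ, b ≠ m + 1 := fun m hm => hb (m + 1) (by push_cast; exact hm)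
      have hab' := regular_iff.2 hab
      refine ⟨_, levelFourRing.mul_mem (hpow n) (bellEval_sub_mem h1 hab' hKa
        (polygammaValuesIn_levelFourRing hab' ⟨p + 4 - q, by push_cast; linarith⟩)
        (bellPair n).1), ?_⟩
      rw [shiftedSum_eq_generic h1 hb' hab' h2, betaValue, Real.Gamma_add_one ha]
      ring
    · have hb' : ∀ m : ℕ, b ≠ m + 1 := fun m hm => hb (m + 1) (by push_cast; exact hm)
      obtain ⟨k, hk⟩ := exists_nat_sub_of_not_regular (a := (a' : ℝ)) (b := b) fun hreg => by
        obtain ⟨m, hm⟩ := hab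
        exact regular_iff.1 hreg m hm
      have hreg : b - a' ∈ regular := by rw [hk]; exact regular_of_pos (by positivity)
      -- The sign and $\Gamma(b-a)=k!$ are absorbed into the ring element; one factor $a$ turns
      -- $\Gamma(a)$ into $\Gamma(a+1)$, leaving $a^n$.
      refine ⟨(((-1) ^ (k + 1) * k.factorial : ℚ) : ℝ) * (a' ^ n * -bellEval (Real.pi ^ 2)
          (fun j => polygamma j a' + (-1) ^ (j + 1) * polygamma j (b - a')) (bellPair n).2),
        levelFourRing.mul_mem (ratCast_mem _ _) (levelFourRing.mul_mem (hpow n)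
          (levelFourRing.neg_mem (bellEval_reflection_mem pi_mem_levelFourRing h1 hreg hKa
            (polygammaValuesIn_levelFourRing hreg ⟨q - p, by push_cast; linarith⟩) _))), ?_⟩
      have hG : Real.Gamma (b - a') = k.factorial := by
        rw [hk, Nat.cast_succ, Real.Gamma_nat_eq_factorial]
      rw [shiftedSum_eq_of_sub_eq_nat h1 hb' (by omega) hk h2, hG, Real.Gamma_add_one ha]
      push_cast
      ring
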